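/- Let $n\ge 1$ and $0<\alpha<2$. Let $L_\alpha$ be the set of measurable functions $u:\mathbb R^n\to\mathbb R$ with $\int_{\mathbb R^n}\frac{|u(x)|}{1+|x|^{n+\alpha}}\,dx<\infty$, and for $\phi\in C_0^\infty(\mathbb R^n)$ (real-valued, smooth, compactly supported) let $$(-\Delta)^{\alpha/2}\phi(x)=C_{n,\alpha}\lim_{\epsilon\to0^+}\int_{\mathbb R^n\setminus B_\epsilon(x)}\frac{\phi(x)-\phi(z)}{|x-z|^{n+\alpha}}\,dz,\qquad C_{n,\alpha}=\frac{2^\alpha\,\Gamma\!\left(\frac{n+\alpha}{2}\right)}{\pi^{n/2}\,|\Gamma(-\alpha/2)|}.$$ Let $u\in L_\alpha$ be $\alpha$-harmonic, that is, $\int_{\mathbb R^n}u(x)\,(-\Delta)^{\alpha/2}\phi(x)\,dx=0$ for all $\phi\in C_0^\infty(\mathbb R^n)$. Then $u$ is affine: there are $b\in\mathbb R^n$ and $c\in\mathbb R$ with $u(x)=b\cdot x+c$ for almost every $x\in\mathbb R^n$. If moreover $\alpha\le 1$, then $u$ is constant almost everywhere. -/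

import Mathlib

open MeasureTheory Filter Topology
open scoped ContDiff

noncomputable section

namespace FracLaplace

/-- The normalising constant of the fractional Laplacian,
`C_{n,α} = 2^α Γ((n+α)/2) / (π^{n/2} |Γ(-α/2)|)`: the one for which `(-Δ)^{α/2}` has the
Fourier symbol `|ξ|^α`. -/
def normConst (n : ℕ) (α : ℝ) : ℝ :=
  (2 : ℝ) ^ α * Real.Gamma (((n : ℝ) + α) / 2) /
    (Real.pi ^ ((n : ℝ) / 2) * |Real.Gamma (-α / 2)|)

/-- The integral of `(f x - f z) / |x - z|^(n+α)` over the `z` outside the ball `B_ε(x)`. -/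
def truncated {n : ℕ} (α : ℝ) (f : EuclideanSpace ℝ (Fin n) → ℝ)
    (x : EuclideanSpace ℝ (Fin n)) (ε : ℝ) : ℝ :=
  ∫ z in (Metric.ball x ε)ᶜ, (f x - f z) / ‖x - z‖ ^ ((n : ℝ) + α)

/-- The fractional Laplacian `(-Δ)^{α/2} f`, as a principal value integral. In the definition of
`α`-harmonic functions it is applied only to smooth compactly supported `f`, for which (when
`0 < α < 2`) the limit exists at every point. -/
def fracLaplacian {n : ℕ} (α : ℝ) (f : EuclideanSpace ℝ (Fin n) → ℝ)
    (x : EuclideanSpace ℝ (Fin n)) : ℝ :=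
  normConst n α * limUnder (𝓝[>] (0 : ℝ)) (truncated α f x)

/-- The space `L_α` of (Lebesgue measurable) functions with
`∫ |u(x)| / (1 + |x|^(n+α)) dx < ∞`. -/
def LSpace (n : ℕ) (α : ℝ) : Set (EuclideanSpace ℝ (Fin n) → ℝ) :=
  {u | AEStronglyMeasurable u volume ∧
    Integrable (fun x => |u x| / (1 + ‖x‖ ^ ((n : ℝ) + α))) volume}

/-- `u` is `α`-harmonic: `u ∈ L_α` and `(-Δ)^{α/2} u = 0` in the sense of distributions. -/
def IsAlphaHarmonic {n : ℕ} (α : ℝ) (u : EuclideanSpace ℝ (Fin n) → ℝ) : Prop :=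
  u ∈ LSpace n α ∧
    ∀ φ : EuclideanSpace ℝ (Fin n) → ℝ, ContDiff ℝ ∞ φ → HasCompactSupport φ →
      ∫ x, u x * fracLaplacian α φ x = 0

end FracLaplace

end

noncomputable section

namespace FracLaplace

/-! The Fourier transform of `u` is supported at the origin, so `u` should be a polynomial whose
degree is limited by its growth. The proof realises this without the structure theory of
distributions.

Write d for the dimension and s = d + α. On Schwartz functions the fractional Laplacian is, up to a
positive factor, the absolutely convergent `singularIntegral`. Its values decay like `weight s`,
precisely the decay that can be paired with `u`, so harmonicity extends from test functions to
Schwartz functions (`WeakHarmonic.integral_eq_zero_of_schwartz`). Its Fourier symbol is c‖ξ‖^α with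
c > 0 (`exists_symbol_eq`). Division by the symbol shows that `u` annihilates the inverse Fourier
transform of every test function vanishing near 0 (`WeakHarmonic.integral_fourierInv_eq_zero`).

Let θ be a cut-off equal to 1 near 0, k its inverse transform and k_R(z) = R^d k(Rz). Since θ(ξ/R) -
θ(ξ) vanishes near 0, the average F(x) = ∫ u(y) k_R(y - x) dy does not depend on R
(`WeakHarmonic.exists_scale_invariant_kernel`). The two ends of the scale now give everything. As R
→ ∞, k_R is an approximate identity, so u = F almost everywhere (`WeakHarmonic.ae_eq_average`). As R
→ 0, an m-th difference of k_R gains R^m, while comparing `weight s (R • z)` with `weight s z` costs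
R^(-s); the net power is R^(d+m-s) = R^(m-α). For m = 2, and for m = 1 if α ≤ 1, dominated
convergence makes the m-th differences of F vanish. Being continuous, F is affine, respectively
constant. -/

/-- The polynomial weight `(1 + ‖x‖) ^ (-s)`. -/
def weight {E : Type*} [NormedAddCommGroup E] (s : ℝ) (x : E) : ℝ := (1 + ‖x‖) ^ (-s)

/-! ### Polynomial weights and Peetre's inequality -/

section Weight

variable {E : Type*} [NormedAddCommGroup E]

theorem weight_pos (s : ℝ) (x : E) : 0 < weight s x := by
  unfold weight; positivity

theorem weight_le_one {s : ℝ} (hs : 0 ≤ s) (x : E) : weight s x ≤ 1 :=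
  Real.rpow_le_one_of_one_le_of_nonpos (by linarith [norm_nonneg x]) (by linarith)

theorem continuous_weight (s : ℝ) : Continuous (weight s : E → ℝ) := by
  unfold weight
  exact (continuous_const.add continuous_norm).rpow_const
    fun x => Or.inl (add_pos_of_pos_of_nonneg one_pos (norm_nonneg x)).ne'

theorem weight_neg (s : ℝ) (x : E) : weight s (-x) = weight s x := by simp [weight]

theorem weight_add (s t : ℝ) (x : E) : weight (s + t) x = weight s x * weight t x := by
  unfold weight
  rw [neg_add, Real.rpow_add (by positivity)]

theorem rpow_mul_weight (s : ℝ) (x : E) : (1 + ‖x‖) ^ s * weight s x = 1 := by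
  unfold weight
  rw [← Real.rpow_add (by positivity)]; simp

theorem weight_anti {s t : ℝ} (h : s ≤ t) (x : E) : weight t x ≤ weight s x :=
  Real.rpow_le_rpow_of_exponent_le (by linarith [norm_nonneg x]) (by linarith)

theorem one_add_norm_add_le (x y : E) : 1 + ‖x + y‖ ≤ (1 + ‖x‖) * (1 + ‖y‖) := by
  nlinarith [norm_add_le x y, mul_nonneg (norm_nonneg x) (norm_nonneg y)]

/-- Peetre's inequality, from submultiplicativity of 1 + ‖·‖ applied to x = (x + y) + (-y):
translating a decay estimate costs only a polynomial factor in the shift. -/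
theorem weight_add_le {s : ℝ} (hs : 0 ≤ s) (x y : E) :
    weight s (x + y) ≤ (1 + ‖y‖) ^ s * weight s x := by
  have h : (1 + ‖x‖) ^ s ≤ (1 + ‖x + y‖) ^ s * (1 + ‖y‖) ^ s := by
    rw [← Real.mul_rpow (by positivity) (by positivity)]
    refine Real.rpow_le_rpow (by positivity) ?_ hs
    have := one_add_norm_add_le (x + y) (-y)
    simpa using this
  unfold weight
  rw [Real.rpow_neg (by positivity), Real.rpow_neg (by positivity), ← div_eq_mul_inv,
    le_div_iff₀ (by positivity), inv_mul_le_iff₀ (by positivity)]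
  exact h

theorem weight_sub_le {s : ℝ} (hs : 0 ≤ s) (x y : E) :
    weight s (x - y) ≤ (1 + ‖y‖) ^ s * weight s x := by
  simpa [sub_eq_add_neg] using weight_add_le hs x (-y)

/-- For R ≤ 1, R(1 + ‖x‖) ≤ 1 + ‖R • x‖. The loss R^(-s) is what differences of a dilated kernel
must compensate. -/
theorem weight_smul_le {s R : ℝ} (hs : 0 ≤ s) (hR : 0 < R) (hR1 : R ≤ 1) (x : E) [NormedSpace ℝ E] :
    weight s (R • x) ≤ R ^ (-s) * weight s x := by
  unfold weight
  rw [← Real.mul_rpow hR.le (by positivity), norm_smul, Real.norm_of_nonneg hR.le]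
  refine Real.rpow_le_rpow_of_nonpos (by positivity) ?_ (by linarith)
  nlinarith [norm_nonneg x]

end Weight

/-! ### Weighted bounds for first and second differences -/

section Difference

variable {E V : Type*} [NormedAddCommGroup E] [NormedSpace ℝ E] [NormedAddCommGroup V]
  [NormedSpace ℝ V]

/-- Mean value inequality on the closed ball of radius ‖y‖ about z, where Peetre's inequality
compares all weights with the one at z. -/
theorem norm_first_difference_le {s A : ℝ} (hs : 0 ≤ s) (hA : 0 ≤ A) {f : E → V}
    (hf : Differentiable ℝ f) (h : ∀ z, ‖fderiv ℝ f z‖ ≤ A * weight s z) (z y : E) :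
    ‖f (z + y) - f z‖ ≤ A * (1 + ‖y‖) ^ s * ‖y‖ * weight s z := by
  have key := Convex.norm_image_sub_le_of_norm_fderiv_le (𝕜 := ℝ) (f := f)
    (C := A * ((1 + ‖y‖) ^ s * weight s z)) (s := Metric.closedBall z ‖y‖) (x := z) (y := z + y)
    (fun x _ => hf x) ?_ (convex_closedBall _ _) (by simp) (by simp)
  · rw [add_sub_cancel_left] at key
    calc _ ≤ _ := key
      _ = _ := by ring
  · intro x hx
    refine (h x).trans (mul_le_mul_of_nonneg_left ?_ hA)
    have h1 := weight_add_le hs z (x - z)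
    rw [add_sub_cancel] at h1
    refine h1.trans (mul_le_mul_of_nonneg_right ?_ (weight_pos _ _).le)
    refine Real.rpow_le_rpow (by positivity) ?_ hs
    have : ‖x - z‖ ≤ ‖y‖ := by simpa [dist_eq_norm] using hx
    linarith

/-- The first-difference bound is used twice: on `fderiv ℝ f`, which controls the derivative of z ↦
f (z + y) - f z, and then on that function with increment k. -/
theorem norm_second_difference_le {s A : ℝ} (hs : 0 ≤ s) (hA : 0 ≤ A) {f : E → V}
    (hf : ContDiff ℝ 2 f) (h : ∀ z, ‖iteratedFDeriv ℝ 2 f z‖ ≤ A * weight s z) (z y k : E) :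
    ‖f (z + y + k) - f (z + y) - f (z + k) + f z‖ ≤
      A * ((1 + ‖y‖) ^ s * (1 + ‖k‖) ^ s * ‖y‖ * ‖k‖) * weight s z := by
  have hd : Differentiable ℝ f := hf.differentiable (by norm_num)
  have hd' : Differentiable ℝ (fderiv ℝ f) :=
    (hf.fderiv_right (m := 1) (by norm_num)).differentiable (by norm_num)
  have h1 : ∀ z, ‖fderiv ℝ (fderiv ℝ f) z‖ ≤ A * weight s z := by
    intro z
    rw [← norm_iteratedFDeriv_zero (𝕜 := ℝ) (f := fderiv ℝ (fderiv ℝ f)),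
      norm_iteratedFDeriv_fderiv, norm_iteratedFDeriv_fderiv]
    exact h z
  have h2 := norm_first_difference_le hs hA hd' h1
  have hsh : ∀ z, HasFDerivAt (fun z => f (z + y) - f z) (fderiv ℝ f (z + y) - fderiv ℝ f z) z := by
    intro z
    exact ((hasFDerivAt_comp_add_right y).2 (hd (z + y)).hasFDerivAt).sub (hd z).hasFDerivAt
  have h3 := norm_first_difference_le (f := fun z => f (z + y) - f z)
    (A := A * (1 + ‖y‖) ^ s * ‖y‖) hs (by positivity) (fun z => (hsh z).differentiableAt)
    (fun z => by rw [(hsh z).fderiv]; exact h2 z y) z k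
  calc _ = ‖(f (z + k + y) - f (z + k)) - (f (z + y) - f z)‖ := by
        rw [add_right_comm]; congr 1; abel
    _ ≤ _ := h3
    _ = _ := by ring

end Difference

/-! ### Integrability of the singular kernel -/

section Kernel

variable {E : Type*} [NormedAddCommGroup E] [InnerProductSpace ℝ E] [FiniteDimensional ℝ E]
  [MeasurableSpace E] [BorelSpace E]

theorem integrable_weight {s : ℝ} (hs : (Module.finrank ℝ E : ℝ) < s) :
    Integrable (weight s : E → ℝ) := integrable_one_add_norm hs

/-- In polar coordinates the radial integrand is r^(1-α) on (0, 1], integrable as α < 2, and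
r^(-1-α) beyond 1, integrable as α > 0. -/
theorem integrable_min_kernel [Nontrivial E] {α : ℝ} (h0 : 0 < α) (h2 : α < 2) :
    Integrable (fun y : E => (‖y‖ ^ ((Module.finrank ℝ E : ℝ) + α))⁻¹ * min 1 (‖y‖ ^ 2)) := by
  set d := Module.finrank ℝ E with hd
  have hdpos : 0 < d := Module.finrank_pos
  rw [MeasureTheory.integrable_fun_norm_addHaar (volume : Measure E)
    (f := fun r : ℝ => (r ^ ((d : ℝ) + α))⁻¹ * min 1 (r ^ 2))]
  rw [← Set.Ioc_union_Ioi_eq_Ioi zero_le_one, integrableOn_union]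
  have hcast : ((d - 1 : ℕ) : ℝ) = (d : ℝ) - 1 := by
    rw [Nat.cast_sub hdpos]; simp
  constructor
  · have h := (intervalIntegral.intervalIntegrable_rpow' (a := 0) (b := 1)
      (r := 1 - α) (by linarith))
    rw [intervalIntegrable_iff_integrableOn_Ioc_of_le zero_le_one] at h
    refine h.congr_fun (fun y hy => ?_) measurableSet_Ioc
    have hy0 : 0 < y := hy.1
    have : min 1 (y ^ 2) = y ^ (2 : ℝ) := by
      rw [min_eq_right (by nlinarith [hy.2])]; norm_cast
    simp only [smul_eq_mul]
    rw [this, ← Real.rpow_neg hy0.le, ← Real.rpow_natCast, ← Real.rpow_add hy0,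
      ← Real.rpow_add hy0, hcast]
    congr 1; ring
  · have h := integrableOn_Ioi_rpow_of_lt (a := -1 - α) (c := 1) (by linarith) one_pos
    refine h.congr_fun (fun y hy => ?_) measurableSet_Ioi
    have hy1 : 1 < y := hy
    have hy0 : 0 < y := by linarith
    simp only [smul_eq_mul]
    rw [min_eq_left (by nlinarith), mul_one, ← Real.rpow_neg hy0.le, ← Real.rpow_natCast,
      ← Real.rpow_add hy0, hcast]
    congr 1; ring

end Kernel

theorem weight_mul_weight_le {E : Type*} [NormedAddCommGroup E] {s : ℝ} (hs : 0 ≤ s) (x y : E) :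
    weight s x * weight s y ≤ weight s (x + y) := by
  have h := weight_sub_le hs (x + y) y
  rw [add_sub_cancel_right] at h
  calc weight s x * weight s y ≤ (1 + ‖y‖) ^ s * weight s (x + y) * weight s y :=
        mul_le_mul_of_nonneg_right h (weight_pos _ _).le
    _ = weight s (x + y) * ((1 + ‖y‖) ^ s * weight s y) := by ring
    _ = _ := by rw [rpow_mul_weight, mul_one]

/-- The negative symmetric second difference `2 f x - f (x + y) - f (x - y)`. -/
def symmDiff₂ {E V : Type*} [AddGroup E] [AddGroup V] (f : E → V) (x y : E) : V :=
  f x + f x - f (x + y) - f (x - y)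

/-! ### Decay of the singular integral -/

section SingularIntegral

variable {E : Type*} [NormedAddCommGroup E] [InnerProductSpace ℝ E]
  {V : Type*} [NormedAddCommGroup V] [NormedSpace ℝ V]

/-- The (unnormalised) fractional Laplacian, as an absolutely convergent integral of symmetric
second differences against `‖y‖ ^ (-s)`. -/
def singularIntegral [MeasurableSpace E] [BorelSpace E] [FiniteDimensional ℝ E]
    (s : ℝ) (f : E → V) (x : E) : V :=
  ∫ y, (‖y‖ ^ s)⁻¹ • symmDiff₂ f x y

/-- Quantitative decay of a `C²` function and its second derivative, sufficient for its
fractional Laplacian of order `s - finrank ℝ E` to decay like `weight s`. -/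
structure HasDecay (s A : ℝ) (f : E → V) : Prop where
  contDiff : ContDiff ℝ 2 f
  nonneg : 0 ≤ A
  norm_le : ∀ z, ‖f z‖ ≤ A * weight (s + (Module.finrank ℝ E + 1)) z
  norm_deriv_le : ∀ z, ‖iteratedFDeriv ℝ 2 f z‖ ≤ A * weight s z

/-- The majorant of the integrand of `singularIntegral`, relative to `weight s x`. -/
def majorant (s : ℝ) (x y : E) : ℝ :=
  ((2 : ℝ) ^ s * 2 ^ s + 2) * ((‖y‖ ^ s)⁻¹ * min 1 (‖y‖ ^ 2)) +
    2 ^ s * (weight (Module.finrank ℝ E + 1) (x + y) + weight (Module.finrank ℝ E + 1) (x - y))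

/-- For ‖y‖ ≤ 1 the second derivative supplies ‖y‖^2. For ‖y‖ > 1 the kernel is at most `2 ^ s *
weight s y`, and `weight s y * weight s (x ± y) ≤ weight s x`: this spends s of the decay of f and
leaves an integrable weight of exponent `finrank + 1`. -/
theorem HasDecay.norm_integrand_le {s A : ℝ} (hs : 0 < s) {f : E → V} (hf : HasDecay s A f)
    (x y : E) :
    ‖(‖y‖ ^ s)⁻¹ • symmDiff₂ f x y‖ ≤ A * weight s x * majorant s x y := by
  have hA := hf.nonneg
  have hw := weight_pos s x
  have hw1 := (weight_pos (Module.finrank ℝ E + 1) (x + y))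
  have hw2 := (weight_pos (Module.finrank ℝ E + 1) (x - y))
  have h2s : (0 : ℝ) < 2 ^ s := by positivity
  have hk : 0 ≤ (‖y‖ ^ s)⁻¹ := by positivity
  rw [norm_smul, Real.norm_of_nonneg hk]
  rcases le_or_gt ‖y‖ 1 with hy | hy
  · have h1 : ‖symmDiff₂ f x y‖ ≤ A * (2 ^ s * 2 ^ s * ‖y‖ ^ 2) * weight s x := by
      have h := norm_second_difference_le hs.le hA hf.contDiff hf.norm_deriv_le x y (-y)
      have e : f (x + y + -y) - f (x + y) - f (x + -y) + f x = symmDiff₂ f x y := by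
        simp only [symmDiff₂, add_neg_cancel_right, sub_eq_add_neg]; abel
      rw [e, norm_neg] at h
      refine h.trans ?_
      have h3 : (1 + ‖y‖) ^ s ≤ 2 ^ s := Real.rpow_le_rpow (by positivity) (by linarith) hs.le
      have h4 : (1 + ‖y‖) ^ s * (1 + ‖y‖) ^ s * ‖y‖ * ‖y‖ ≤ 2 ^ s * 2 ^ s * ‖y‖ ^ 2 := by
        calc _ = ((1 + ‖y‖) ^ s * (1 + ‖y‖) ^ s) * ‖y‖ ^ 2 := by ring
          _ ≤ _ := by gcongr
      gcongr
    have hmin : min 1 (‖y‖ ^ 2) = ‖y‖ ^ 2 := min_eq_right (by nlinarith [norm_nonneg y])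
    calc (‖y‖ ^ s)⁻¹ * ‖symmDiff₂ f x y‖
        ≤ (‖y‖ ^ s)⁻¹ * (A * (2 ^ s * 2 ^ s * ‖y‖ ^ 2) * weight s x) := by gcongr
      _ = A * weight s x * ((2 ^ s * 2 ^ s) * ((‖y‖ ^ s)⁻¹ * ‖y‖ ^ 2)) := by ring
      _ ≤ A * weight s x * majorant s x y := by
        refine mul_le_mul_of_nonneg_left ?_ (by positivity)
        unfold majorant
        rw [hmin]
        have : 0 ≤ (‖y‖ ^ s)⁻¹ * ‖y‖ ^ 2 := by positivity
        nlinarith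
  · have hmin : min 1 (‖y‖ ^ 2) = 1 := min_eq_left (by nlinarith)
    have hky : (‖y‖ ^ s)⁻¹ ≤ 2 ^ s * weight s y := by
      unfold weight
      rw [Real.rpow_neg (by positivity), ← div_eq_mul_inv, le_div_iff₀ (by positivity),
        inv_mul_le_iff₀ (by positivity), ← Real.mul_rpow (by positivity) (by positivity)]
      exact Real.rpow_le_rpow (by positivity) (by linarith) hs.le
    have hfar : ∀ z, weight s y * weight s z ≤ weight s x →
        (‖y‖ ^ s)⁻¹ * ‖f z‖ ≤ A * weight s x * (2 ^ s * weight (Module.finrank ℝ E + 1) z) := by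
      intro z hz
      have hz1 := (weight_pos (Module.finrank ℝ E + 1) z).le
      have hz2 := (weight_pos s z).le
      have hz3 := (weight_pos s y).le
      calc (‖y‖ ^ s)⁻¹ * ‖f z‖
          ≤ (2 ^ s * weight s y) * (A * weight (s + (Module.finrank ℝ E + 1)) z) := by
            gcongr; exact hf.norm_le z
        _ = (weight s y * weight s z) * (A * (2 ^ s * weight (Module.finrank ℝ E + 1) z)) := by
            rw [weight_add]; ring
        _ ≤ weight s x * (A * (2 ^ s * weight (Module.finrank ℝ E + 1) z)) := by gcongr
        _ = _ := by ring
    have h1 := hfar (x + y) (by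
      have := weight_mul_weight_le hs.le (-y) (x + y)
      rwa [weight_neg, neg_add_cancel_comm_assoc] at this)
    have h2 := hfar (x - y) (by
      have := weight_mul_weight_le hs.le y (x - y)
      rwa [add_sub_cancel] at this)
    have h0 : ‖f x‖ ≤ A * weight s x :=
      (hf.norm_le x).trans (mul_le_mul_of_nonneg_left (weight_anti (by simp; positivity) x) hA)
    have htri : ‖symmDiff₂ f x y‖ ≤ ‖f x‖ + ‖f x‖ + ‖f (x + y)‖ + ‖f (x - y)‖ := by
      unfold symmDiff₂
      exact (norm_sub_le _ _).trans (add_le_add_left ((norm_sub_le _ _).trans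
        (add_le_add_left (norm_add_le _ _) _)) _)
    calc (‖y‖ ^ s)⁻¹ * ‖symmDiff₂ f x y‖
        ≤ (‖y‖ ^ s)⁻¹ * (A * weight s x + A * weight s x + ‖f (x + y)‖ + ‖f (x - y)‖) := by
          refine mul_le_mul_of_nonneg_left ?_ hk
          linarith
      _ = A * weight s x * (2 * (‖y‖ ^ s)⁻¹) + (‖y‖ ^ s)⁻¹ * ‖f (x + y)‖ +
          (‖y‖ ^ s)⁻¹ * ‖f (x - y)‖ := by ring
      _ ≤ A * weight s x * (2 * (‖y‖ ^ s)⁻¹) +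
          A * weight s x * (2 ^ s * weight (Module.finrank ℝ E + 1) (x + y)) +
          A * weight s x * (2 ^ s * weight (Module.finrank ℝ E + 1) (x - y)) := by gcongr
      _ = A * weight s x * (2 * (‖y‖ ^ s)⁻¹ + 2 ^ s * (weight (Module.finrank ℝ E + 1) (x + y) +
          weight (Module.finrank ℝ E + 1) (x - y))) := by ring
      _ ≤ A * weight s x * majorant s x y := by
        refine mul_le_mul_of_nonneg_left ?_ (by positivity)
        unfold majorant
        rw [hmin, mul_one]
        have : 0 ≤ 2 ^ s * (2 : ℝ) ^ s * (‖y‖ ^ s)⁻¹ := by positivity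
        linarith

variable [MeasurableSpace E] [BorelSpace E] [FiniteDimensional ℝ E] {α : ℝ}

theorem aestronglyMeasurable_integrand (s : ℝ) {f : E → V} (hf : Continuous f) (x : E) :
    AEStronglyMeasurable (fun y => (‖y‖ ^ s)⁻¹ • symmDiff₂ f x y) := by
  have h1 : Measurable (fun y : E => (‖y‖ ^ s)⁻¹) := by fun_prop
  have h2 : Continuous (fun y : E => symmDiff₂ f x y) := by unfold symmDiff₂; fun_prop
  exact h1.aestronglyMeasurable.smul h2.aestronglyMeasurable

theorem aestronglyMeasurable_singularIntegral (s : ℝ) {f : E → V} (hf : Continuous f) :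
    AEStronglyMeasurable (singularIntegral s f) := by
  have h1 : Measurable (fun p : E × E => (‖p.2‖ ^ s)⁻¹) := by fun_prop
  have h2 : Continuous (fun p : E × E => symmDiff₂ f p.1 p.2) := by unfold symmDiff₂; fun_prop
  have h : AEStronglyMeasurable (fun p : E × E => (‖p.2‖ ^ s)⁻¹ • symmDiff₂ f p.1 p.2)
      ((volume : Measure E).prod volume) :=
    h1.aestronglyMeasurable.smul h2.aestronglyMeasurable
  exact h.integral_prod_right'

variable [Nontrivial E]

theorem integrable_majorant (h0 : 0 < α) (h2 : α < 2) (x : E) :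
    Integrable (majorant (Module.finrank ℝ E + α) x) := by
  have hw : Integrable (weight (Module.finrank ℝ E + 1) : E → ℝ) :=
    integrable_weight (by linarith)
  exact ((integrable_min_kernel h0 h2).const_mul _).add
    (((hw.comp_add_left x).add (hw.comp_sub_left x)).const_mul _)

/-- The point x enters only through translated and reflected weights, so invariance of the measure
removes it. This makes the decay constant of the singular integral uniform in x. -/
theorem integral_majorant (h0 : 0 < α) (h2 : α < 2) (x : E) :
    ∫ y, majorant (Module.finrank ℝ E + α) x y =
      ∫ y, majorant (Module.finrank ℝ E + α) (0 : E) y := by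
  have hw : Integrable (weight (Module.finrank ℝ E + 1) : E → ℝ) :=
    integrable_weight (by linarith)
  have key : ∀ x : E, ∫ y, majorant (Module.finrank ℝ E + α) x y =
      ((2 : ℝ) ^ ((Module.finrank ℝ E : ℝ) + α) * 2 ^ ((Module.finrank ℝ E : ℝ) + α) + 2) *
        (∫ y : E, (‖y‖ ^ ((Module.finrank ℝ E : ℝ) + α))⁻¹ * min 1 (‖y‖ ^ 2)) +
      2 ^ ((Module.finrank ℝ E : ℝ) + α) * ((∫ y : E, weight (Module.finrank ℝ E + 1) y) +
        ∫ y : E, weight (Module.finrank ℝ E + 1) y) := by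
    intro x
    have hsum : Integrable (fun y => weight (Module.finrank ℝ E + 1) (x + y) +
        weight (Module.finrank ℝ E + 1) (x - y)) := (hw.comp_add_left x).add (hw.comp_sub_left x)
    unfold majorant
    rw [integral_add ((integrable_min_kernel h0 h2).const_mul _) (hsum.const_mul _), integral_const_mul,
      integral_const_mul, integral_add (hw.comp_add_left x) (hw.comp_sub_left x),
      integral_add_left_eq_self (fun y => weight (Module.finrank ℝ E + 1) y) x,
      integral_sub_left_eq_self (fun y => weight (Module.finrank ℝ E + 1) y) volume x]
  rw [key, key]

theorem HasDecay.integrable_integrand (h0 : 0 < α) (h2 : α < 2) {A : ℝ} {f : E → V}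
    (hf : HasDecay (Module.finrank ℝ E + α) A f) (x : E) :
    Integrable (fun y => (‖y‖ ^ ((Module.finrank ℝ E : ℝ) + α))⁻¹ • symmDiff₂ f x y) :=
  ((integrable_majorant h0 h2 x).const_mul _).mono'
    (aestronglyMeasurable_integrand _ hf.contDiff.continuous x)
    (Eventually.of_forall fun y => hf.norm_integrand_le (by positivity) x y)

theorem HasDecay.norm_singularIntegral_le (h0 : 0 < α) (h2 : α < 2) {A : ℝ} {f : E → V}
    (hf : HasDecay (Module.finrank ℝ E + α) A f) (x : E) :
    ‖singularIntegral (Module.finrank ℝ E + α) f x‖ ≤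
      A * (∫ y, majorant (Module.finrank ℝ E + α) (0 : E) y) *
        weight (Module.finrank ℝ E + α) x := by
  refine (norm_integral_le_of_norm_le ((integrable_majorant h0 h2 x).const_mul _)
    (Eventually.of_forall fun y => hf.norm_integrand_le (by positivity) x y)).trans_eq ?_
  rw [integral_const_mul, integral_majorant h0 h2 x]; ring

end SingularIntegral

theorem norm_smul_le_mul_norm_weight {E V : Type*} [NormedAddCommGroup E]
    [NormedAddCommGroup V] [NormedSpace ℝ V] {u : E → ℝ} {s C : ℝ} {g : V} {x : E} (hg : ‖g‖ ≤ C * weight s x) :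
    ‖u x • g‖ ≤ C * ‖u x * weight s x‖ := by
  rw [norm_smul, norm_mul, Real.norm_of_nonneg (weight_pos s x).le]
  calc _ ≤ ‖u x‖ * (C * weight s x) := by gcongr
    _ = _ := by ring

/-! ### Extending harmonicity from test functions to Schwartz functions -/

section WeakHarmonic

variable {E : Type*} [NormedAddCommGroup E] [InnerProductSpace ℝ E]
  {V : Type*} [NormedAddCommGroup V] [NormedSpace ℝ V]

theorem exists_norm_iteratedFDeriv_le_weight (f : SchwartzMap E V) (r : ℝ) (m : ℕ) :
    ∃ A, 0 ≤ A ∧ ∀ i ≤ m, ∀ z, ‖iteratedFDeriv ℝ i f z‖ ≤ A * weight r z := by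
  set A := 2 ^ ⌈r⌉₊ *
    ((Finset.Iic (⌈r⌉₊, m)).sup fun m => SchwartzMap.seminorm ℝ (E := E) (F := V) m.1 m.2) f
    with hA
  have hA0 : 0 ≤ A := mul_nonneg (by positivity) (apply_nonneg _ _)
  refine ⟨A, hA0, fun i hi z => ?_⟩
  have h := SchwartzMap.one_add_le_sup_seminorm_apply (𝕜 := ℝ) (m := (⌈r⌉₊, m)) (k := ⌈r⌉₊)
    (n := i) le_rfl hi f z
  have h1 : weight (⌈r⌉₊ : ℝ) z ≤ weight r z := weight_anti (Nat.le_ceil r) z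
  refine le_trans ?_ (mul_le_mul_of_nonneg_left h1 hA0)
  unfold weight
  rw [Real.rpow_neg (by positivity), Real.rpow_natCast, ← div_eq_mul_inv,
    le_div_iff₀ (by positivity), mul_comm]
  exact h

theorem hasDecay_of_forall_le {s A : ℝ} (hA : 0 ≤ A) {f : E → V} (hf : ContDiff ℝ 2 f)
    (h : ∀ i ≤ 2, ∀ z,
      ‖iteratedFDeriv ℝ i f z‖ ≤ A * weight (s + (Module.finrank ℝ E + 1)) z) :
    HasDecay s A f where
  contDiff := hf
  nonneg := hA
  norm_le z := by simpa using h 0 (by norm_num) z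
  norm_deriv_le z := (h 2 le_rfl z).trans
    (mul_le_mul_of_nonneg_left (weight_anti (by simp; positivity) z) hA)

theorem exists_hasDecay (s : ℝ) (f : SchwartzMap E V) : ∃ A, HasDecay s A f := by
  obtain ⟨A, hA, h⟩ := exists_norm_iteratedFDeriv_le_weight f (s + (Module.finrank ℝ E + 1)) 2
  exact ⟨A, hasDecay_of_forall_le hA (f.smooth 2) h⟩

/-- Derivatives of χ(a·) carry factors a^i of size at most 1, so the Leibniz rule gives one constant
for all wide cut-offs; 4 = 2^2 bounds the sum of binomial coefficients. -/
theorem exists_uniform_hasDecay_cutoff {s : ℝ} {χ : E → ℝ} (hχ : ContDiff ℝ ∞ χ)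
    (hχc : HasCompactSupport χ) (f : SchwartzMap E V) :
    ∃ A, ∀ a : ℝ, |a| ≤ 1 → HasDecay s A (fun x => χ (a • x) • f x) := by
  obtain ⟨B, hB, hχB⟩ := exists_norm_iteratedFDeriv_le_weight (hχc.toSchwartzMap hχ) 0 2
  obtain ⟨A, hA, h⟩ := exists_norm_iteratedFDeriv_le_weight f (s + (Module.finrank ℝ E + 1)) 2
  have hχ2 : ContDiff ℝ 2 χ := by exact_mod_cast contDiff_infty.1 hχ 2
  refine ⟨4 * B * A, fun a ha => ?_⟩
  have hχa : ContDiff ℝ 2 (fun x : E => χ (a • x)) := hχ2.comp (contDiff_const_smul a)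
  have hb : ∀ i ≤ 2, ∀ z, ‖iteratedFDeriv ℝ i (fun x : E => χ (a • x)) z‖ ≤ B := by
    intro i hi z
    rw [iteratedFDeriv_comp_const_smul a (hχ2.of_le (by exact_mod_cast hi)), norm_smul]
    have h1 : ‖iteratedFDeriv ℝ i χ (a • z)‖ ≤ B := by
      have := hχB i hi (a • z)
      simp only [weight, neg_zero, Real.rpow_zero, mul_one] at this
      exact this
    have h2 : ‖a ^ i‖ ≤ 1 := by
      rw [norm_pow]; exact pow_le_one₀ (norm_nonneg _) ha
    calc _ ≤ 1 * B := mul_le_mul h2 h1 (norm_nonneg _) zero_le_one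
      _ = B := one_mul B
  refine hasDecay_of_forall_le (by positivity) (hχa.smul (f.smooth 2)) fun i hi z => ?_
  set W := weight (s + (Module.finrank ℝ E + 1)) z
  have hW : 0 < W := weight_pos _ _
  calc _ ≤ ∑ j ∈ Finset.range (i + 1), (i.choose j : ℝ) *
        ‖iteratedFDeriv ℝ j (fun x : E => χ (a • x)) z‖ * ‖iteratedFDeriv ℝ (i - j) f z‖ :=
        norm_iteratedFDeriv_smul_le hχa (f.smooth 2) z (by exact_mod_cast hi)
    _ ≤ ∑ j ∈ Finset.range (i + 1), (i.choose j : ℝ) * (B * (A * W)) := by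
        refine Finset.sum_le_sum fun j hj => ?_
        rw [mul_assoc]
        have hji : j ≤ i := by simpa [Nat.lt_succ_iff] using hj
        gcongr
        · exact hb j (hji.trans hi) z
        · exact h (i - j) ((Nat.sub_le _ _).trans hi) z
    _ = 2 ^ i * (B * (A * W)) := by
        rw [← Finset.sum_mul]; congr 1; exact_mod_cast Nat.sum_range_choose i
    _ ≤ 2 ^ 2 * (B * (A * W)) := by gcongr; norm_num
    _ = 4 * B * A * W := by ring

variable [FiniteDimensional ℝ E] [MeasurableSpace E] [BorelSpace E]

/-- `u` has finite weighted integral and annihilates the (unnormalised) fractional Laplacians of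
order `α` of all real test functions. -/
structure WeakHarmonic (α : ℝ) (u : E → ℝ) : Prop where
  aestronglyMeasurable : AEStronglyMeasurable u
  integrable : Integrable (fun x => u x * weight (Module.finrank ℝ E + α) x)
  integral_eq_zero : ∀ φ : E → ℝ, ContDiff ℝ ∞ φ → HasCompactSupport φ →
    ∫ x, u x * singularIntegral (Module.finrank ℝ E + α) φ x = 0

variable {α : ℝ} {u : E → ℝ}

theorem WeakHarmonic.integrable_smul (hu : WeakHarmonic α u) {g : E → V} {C : ℝ}
    (hgm : AEStronglyMeasurable g) (hg : ∀ x, ‖g x‖ ≤ C * weight (Module.finrank ℝ E + α) x) :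
    Integrable (fun x => u x • g x) :=
  (hu.integrable.norm.const_mul C).mono' (hu.aestronglyMeasurable.smul hgm)
    (Eventually.of_forall fun x => norm_smul_le_mul_norm_weight (hg x))

theorem WeakHarmonic.tendsto_integral {ι : Type*} {l : Filter ι} [l.IsCountablyGenerated]
    (hu : WeakHarmonic α u) {g : ι → E → V} {g' : E → V} {C : ℝ}
    (hgm : ∀ i, AEStronglyMeasurable (g i))
    (hg : ∀ᶠ i in l, ∀ x, ‖g i x‖ ≤ C * weight (Module.finrank ℝ E + α) x)
    (hlim : ∀ x, Tendsto (fun i => g i x) l (𝓝 (g' x))) :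
    Tendsto (fun i => ∫ x, u x • g i x) l (𝓝 (∫ x, u x • g' x)) :=
  tendsto_integral_filter_of_dominated_convergence _
    (Eventually.of_forall fun i => hu.aestronglyMeasurable.smul (hgm i))
    (hg.mono fun _ hi => Eventually.of_forall fun x => norm_smul_le_mul_norm_weight (hi x))
    (hu.integrable.norm.const_mul C)
    (Eventually.of_forall fun x => (hlim x).const_smul (u x))

variable [Nontrivial E]

/-- Real-linear functionals commute with both integrals, so the claim reduces to the real and
imaginary parts of ψ. -/
theorem WeakHarmonic.integral_eq_zero_of_compactSupport (h0 : 0 < α) (h2 : α < 2)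
    (hu : WeakHarmonic α u) {ψ : E → ℂ} (hψ : ContDiff ℝ ∞ ψ) (hψc : HasCompactSupport ψ) :
    ∫ x, u x • singularIntegral (Module.finrank ℝ E + α) ψ x = 0 := by
  obtain ⟨A, hA⟩ : ∃ A, HasDecay (Module.finrank ℝ E + α) A ψ :=
    exists_hasDecay _ (hψc.toSchwartzMap hψ)
  have hint : Integrable (fun x => u x • singularIntegral (Module.finrank ℝ E + α) ψ x) :=
    hu.integrable_smul (aestronglyMeasurable_singularIntegral _ hψ.continuous)
      (hA.norm_singularIntegral_le h0 h2)
  have key : ∀ ℓ : ℂ →L[ℝ] ℝ,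
      ℓ (∫ x, u x • singularIntegral (Module.finrank ℝ E + α) ψ x) = 0 := by
    intro ℓ
    rw [← ℓ.integral_comp_comm hint]
    have h := hu.integral_eq_zero (fun x => ℓ (ψ x)) (ℓ.contDiff.comp hψ)
      (hψc.comp_left (map_zero ℓ))
    rw [← h]
    congr 1 with x
    rw [map_smul, smul_eq_mul]
    congr 1
    unfold singularIntegral
    rw [← ℓ.integral_comp_comm (hA.integrable_integrand h0 h2 x)]
    congr 1 with y
    rw [map_smul]
    simp only [symmDiff₂, map_add, map_sub]
  apply Complex.ext
  · exact key Complex.reCLM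
  · exact key Complex.imCLM

/-- The cut-offs χ(x/(k+1)) f(x) obey one decay bound, so dominated convergence applies twice: in y
inside the singular integral, then in x against `u`. -/
theorem WeakHarmonic.integral_eq_zero_of_schwartz (h0 : 0 < α) (h2 : α < 2)
    (hu : WeakHarmonic α u) (f : SchwartzMap E ℂ) :
    ∫ x, u x • singularIntegral (Module.finrank ℝ E + α) f x = 0 := by
  set s := (Module.finrank ℝ E : ℝ) + α with hs
  have hs0 : 0 < s := by positivity
  let χ : ContDiffBump (0 : E) := ⟨1, 2, one_pos, one_lt_two⟩
  obtain ⟨A, hA⟩ := exists_uniform_hasDecay_cutoff (s := s) χ.contDiff χ.hasCompactSupport f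
  let a : ℕ → ℝ := fun k => 1 / ((k : ℝ) + 1)
  have ha1 : ∀ k, |a k| ≤ 1 := fun k => by
    simp only [a]
    rw [abs_of_nonneg (by positivity), div_le_one (by positivity)]
    linarith [Nat.cast_nonneg (α := ℝ) k]
  have ha0 : ∀ k, a k ≠ 0 := fun k => by simp only [a]; positivity
  have ha : Tendsto a atTop (𝓝 0) := tendsto_one_div_add_atTop_nhds_zero_nat
  let g : ℕ → E → ℂ := fun k x => χ (a k • x) • f x
  have hg : ∀ k, HasDecay s A (g k) := fun k => hA (a k) (ha1 k)
  have hgs : ∀ k, ContDiff ℝ ∞ (g k) := fun k =>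
    (χ.contDiff.comp (contDiff_const_smul (a k))).smul (f.smooth ⊤)
  have hgc : ∀ k, HasCompactSupport (g k) := fun k =>
    (χ.hasCompactSupport.comp_homeomorph (Homeomorph.smulOfNeZero (a k) (ha0 k))).smul_right
  have hglim : ∀ x, Tendsto (fun k => g k x) atTop (𝓝 (f x)) := by
    intro x
    have h1 : Tendsto (fun k => a k • x) atTop (𝓝 0) := by
      simpa using ha.smul_const x
    have h3 : Tendsto (fun k => χ (a k • x)) atTop (𝓝 (χ 0)) :=
      (χ.continuous.tendsto 0).comp h1
    have h4 : χ (0 : E) = 1 := χ.one_of_mem_closedBall (by simp [χ.rIn_pos.le])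
    rw [h4] at h3
    have h5 := h3.smul_const (f x)
    rwa [one_smul] at h5
  have hlim : ∀ x, Tendsto (fun k => singularIntegral s (g k) x) atTop
      (𝓝 (singularIntegral s f x)) := by
    intro x
    refine tendsto_integral_of_dominated_convergence (fun y => A * weight s x * majorant s x y)
      (fun k => aestronglyMeasurable_integrand s (hgs k).continuous x)
      ((integrable_majorant h0 h2 x).const_mul _)
      (fun k => Eventually.of_forall fun y => (hg k).norm_integrand_le hs0 x y)
      (Eventually.of_forall fun y => ?_)
    exact ((((hglim x).add (hglim x)).sub (hglim (x + y))).sub (hglim (x - y))).const_smul _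
  have h := hu.tendsto_integral (fun k => aestronglyMeasurable_singularIntegral s
    (hgs k).continuous) (Eventually.of_forall fun k => (hg k).norm_singularIntegral_le h0 h2) hlim
  have hz : ∀ k, ∫ x, u x • singularIntegral s (g k) x = 0 := fun k =>
    hu.integral_eq_zero_of_compactSupport h0 h2 (hgs k) (hgc k)
  simp only [hz] at h
  exact tendsto_nhds_unique h tendsto_const_nhds

end WeakHarmonic

/-! ### The principal value as an integral of symmetric differences -/

section Truncation

variable {E : Type*} [NormedAddCommGroup E] [InnerProductSpace ℝ E] [FiniteDimensional ℝ E]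
  [MeasurableSpace E] [BorelSpace E] {α : ℝ}

theorem integrableOn_compl_ball_kernel [Nontrivial E] (h0 : 0 < α) (h2 : α < 2) {ε : ℝ}
    (hε : 0 < ε) :
    IntegrableOn (fun y : E => (‖y‖ ^ ((Module.finrank ℝ E : ℝ) + α))⁻¹) (Metric.ball 0 ε)ᶜ := by
  have hm : 0 < min 1 (ε ^ 2) := lt_min one_pos (by positivity)
  refine (((integrable_min_kernel (E := E) h0 h2).const_mul
    (min 1 (ε ^ 2))⁻¹).integrableOn).mono' ?_ ?_
  · have : Measurable (fun y : E => (‖y‖ ^ ((Module.finrank ℝ E : ℝ) + α))⁻¹) := by fun_prop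
    exact this.aestronglyMeasurable
  · refine (ae_restrict_iff' Metric.isOpen_ball.measurableSet.compl).2
      (Eventually.of_forall fun y hy => ?_)
    have hy' : ε ≤ ‖y‖ := by simpa using hy
    have hle : min 1 (ε ^ 2) ≤ min 1 (‖y‖ ^ 2) := by gcongr
    have hk : 0 ≤ (‖y‖ ^ ((Module.finrank ℝ E : ℝ) + α))⁻¹ := by positivity
    rw [Real.norm_of_nonneg hk, mul_left_comm, ← div_eq_inv_mul (min 1 (‖y‖ ^ 2))]
    exact le_mul_of_one_le_right hk ((one_le_div hm).2 hle)

theorem setIntegral_compl_ball_translate (s : ℝ) (f : E → ℝ) (x : E) (ε : ℝ) :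
    ∫ z in (Metric.ball x ε)ᶜ, (f x - f z) / ‖x - z‖ ^ s =
      ∫ y in (Metric.ball 0 ε)ᶜ, (‖y‖ ^ s)⁻¹ * (f x - f (x + y)) := by
  rw [← integral_indicator Metric.isOpen_ball.measurableSet.compl,
    ← integral_indicator Metric.isOpen_ball.measurableSet.compl,
    ← integral_add_left_eq_self _ x]
  congr 1 with y
  simp only [Set.indicator, Set.mem_compl_iff, Metric.mem_ball, dist_self_add_left, dist_zero_right,
    sub_add_cancel_left, norm_neg]
  congr 1
  rw [div_eq_inv_mul]

theorem setIntegral_compl_ball_reflect (s : ℝ) (f : E → ℝ) (x : E) (ε : ℝ) :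
    ∫ y in (Metric.ball 0 ε)ᶜ, (‖y‖ ^ s)⁻¹ * (f x - f (x + y)) =
      ∫ y in (Metric.ball 0 ε)ᶜ, (‖y‖ ^ s)⁻¹ * (f x - f (x - y)) := by
  rw [← integral_indicator Metric.isOpen_ball.measurableSet.compl,
    ← integral_indicator Metric.isOpen_ball.measurableSet.compl,
    ← integral_neg_eq_self]
  congr 1 with y
  simp only [Set.indicator, Set.mem_compl_iff, Metric.mem_ball, dist_zero_right, norm_neg,
    sub_eq_add_neg]

/-- The reflection y ↦ -y preserves the truncated integral; adding both versions symmetrises the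
difference and cancels its first-order part. -/
theorem two_mul_setIntegral_compl_ball [Nontrivial E] (h0 : 0 < α) (h2 : α < 2) {f : E → ℝ}
    (hf : Continuous f) {M : ℝ} (hM : ∀ x, ‖f x‖ ≤ M) (x : E) {ε : ℝ} (hε : 0 < ε) :
    2 * ∫ z in (Metric.ball x ε)ᶜ, (f x - f z) / ‖x - z‖ ^ ((Module.finrank ℝ E : ℝ) + α) =
      ∫ y in (Metric.ball 0 ε)ᶜ, (‖y‖ ^ ((Module.finrank ℝ E : ℝ) + α))⁻¹ • symmDiff₂ f x y := by
  have hint : ∀ g : E → E, Continuous g →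
      IntegrableOn (fun y => (‖y‖ ^ ((Module.finrank ℝ E : ℝ) + α))⁻¹ * (f x - f (g y)))
        (Metric.ball 0 ε)ᶜ := by
    intro g hg
    refine (integrableOn_compl_ball_kernel h0 h2 hε).mul_bdd (c := M + M)
      (by fun_prop) (Eventually.of_forall fun y => ?_)
    exact (norm_sub_le _ _).trans (add_le_add (hM _) (hM _))
  rw [two_mul]
  nth_rw 2 [setIntegral_compl_ball_translate]
  rw [setIntegral_compl_ball_reflect, setIntegral_compl_ball_translate,
    ← integral_add (hint _ (by fun_prop)) (hint _ (by fun_prop))]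
  congr 1 with y
  simp only [symmDiff₂, smul_eq_mul]
  ring

theorem tendsto_setIntegral_compl_ball {s : ℝ} {V : Type*} [NormedAddCommGroup V]
    [NormedSpace ℝ V] {f : E → V} {x : E}
    (hf : Integrable (fun y => (‖y‖ ^ s)⁻¹ • symmDiff₂ f x y)) :
    Tendsto (fun ε : ℝ => ∫ y in (Metric.ball 0 ε)ᶜ, (‖y‖ ^ s)⁻¹ • symmDiff₂ f x y)
      (𝓝[>] 0) (𝓝 (singularIntegral s f x)) := by
  simp_rw [← integral_indicator Metric.isOpen_ball.measurableSet.compl]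
  refine tendsto_integral_filter_of_dominated_convergence _
    (Eventually.of_forall fun ε => hf.aestronglyMeasurable.indicator
      Metric.isOpen_ball.measurableSet.compl)
    (Eventually.of_forall fun ε => Eventually.of_forall fun y => norm_indicator_le_norm_self _ _)
    hf.norm (Eventually.of_forall fun y => ?_)
  -- The origin is never in the truncated domain, but the integrand vanishes there.
  rcases eq_or_ne y 0 with rfl | hy
  · have : (‖(0 : E)‖ ^ s)⁻¹ • symmDiff₂ f x 0 = 0 := by simp [symmDiff₂]
    rw [this]
    refine tendsto_const_nhds.congr fun ε => ?_
    exact ((Set.indicator_apply_eq_zero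
      (f := fun y => (‖y‖ ^ s)⁻¹ • symmDiff₂ f x y)).2 fun _ => this).symm
  · refine tendsto_const_nhds.congr' ?_
    have : ∀ᶠ ε : ℝ in 𝓝[>] 0, ε < ‖y‖ :=
      nhdsWithin_le_nhds (eventually_lt_nhds (norm_pos_iff.2 hy))
    filter_upwards [this] with ε hε
    rw [Set.indicator_of_mem]
    simpa using hε.le

end Truncation

/-! ### From the principal value definition to `WeakHarmonic` -/

section Euclidean

variable {n : ℕ} {α : ℝ}

theorem fracLaplacian_eq_singularIntegral [Nontrivial (EuclideanSpace ℝ (Fin n))] (h0 : 0 < α)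
    (h2 : α < 2) {φ : EuclideanSpace ℝ (Fin n) → ℝ} (hφ : ContDiff ℝ ∞ φ)
    (hφc : HasCompactSupport φ) (x : EuclideanSpace ℝ (Fin n)) :
    fracLaplacian α φ x = normConst n α / 2 *
      singularIntegral (Module.finrank ℝ (EuclideanSpace ℝ (Fin n)) + α) φ x := by
  obtain ⟨A, hA⟩ := exists_hasDecay
    (Module.finrank ℝ (EuclideanSpace ℝ (Fin n)) + α) (hφc.toSchwartzMap hφ)
  have hA' : HasDecay (Module.finrank ℝ (EuclideanSpace ℝ (Fin n)) + α) A φ := hA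
  obtain ⟨M, hM⟩ := hφ.continuous.bounded_above_of_compact_support hφc
  have h := tendsto_setIntegral_compl_ball (hA'.integrable_integrand h0 h2 x)
  have ht : Tendsto (truncated α φ x) (𝓝[>] (0 : ℝ))
      (𝓝 (2⁻¹ * singularIntegral (Module.finrank ℝ (EuclideanSpace ℝ (Fin n)) + α) φ x)) := by
    refine (h.const_mul 2⁻¹).congr' ?_
    filter_upwards [self_mem_nhdsWithin] with ε hε
    rw [← two_mul_setIntegral_compl_ball h0 h2 hφ.continuous hM x hε, ← mul_assoc,
      inv_mul_cancel₀ two_ne_zero, one_mul]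
    simp [truncated]
  unfold fracLaplacian
  rw [ht.limUnder_eq]
  ring

theorem normConst_pos (hn : 0 < n) (h0 : 0 < α) (h2 : α < 2) : 0 < normConst n α := by
  unfold normConst
  have h1 : 0 < Real.Gamma (((n : ℝ) + α) / 2) := Real.Gamma_pos_of_pos (by positivity)
  -- The argument lies strictly between -1 and 0, hence misses the poles of Γ.
  have h3 : Real.Gamma (-α / 2) ≠ 0 := by
    refine Real.Gamma_ne_zero fun m hm => ?_
    have h4 : (0 : ℝ) < m := by linarith
    have h5 : (m : ℝ) < 1 := by linarith
    have h6 : 0 < m := by exact_mod_cast h4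
    have h7 : m < 1 := by exact_mod_cast h5
    omega
  have := abs_pos.2 h3
  positivity

/-- The two weights are comparable, and the factor `normConst n α / 2` is positive, so it cancels.
-/
theorem IsAlphaHarmonic.weakHarmonic [Nontrivial (EuclideanSpace ℝ (Fin n))] (hn : 0 < n)
    (h0 : 0 < α) (h2 : α < 2) {u : EuclideanSpace ℝ (Fin n) → ℝ} (hu : IsAlphaHarmonic α u) :
    WeakHarmonic α u where
  aestronglyMeasurable := hu.1.1
  integrable := by
    refine ((hu.1.2).const_mul 2).mono'
      (hu.1.1.mul (continuous_weight _).aestronglyMeasurable) (Eventually.of_forall fun x => ?_)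
    have hs : (0 : ℝ) ≤ n + α := by positivity
    have h : 1 + ‖x‖ ^ ((n : ℝ) + α) ≤ 2 * (1 + ‖x‖) ^ ((n : ℝ) + α) := by
      have h1 : ‖x‖ ^ ((n : ℝ) + α) ≤ (1 + ‖x‖) ^ ((n : ℝ) + α) :=
        Real.rpow_le_rpow (norm_nonneg x) (by linarith) hs
      have h3 : 1 ≤ (1 + ‖x‖) ^ ((n : ℝ) + α) :=
        Real.one_le_rpow (by linarith [norm_nonneg x]) hs
      linarith
    rw [norm_mul, Real.norm_of_nonneg (weight_pos _ _).le, Real.norm_eq_abs,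
      finrank_euclideanSpace_fin]
    unfold weight
    rw [Real.rpow_neg (by positivity), ← div_eq_mul_inv, ← mul_div_assoc,
      div_le_div_iff₀ (by positivity) (by positivity)]
    nlinarith [abs_nonneg (u x)]
  integral_eq_zero φ hφ hφc := by
    have h := hu.2 φ hφ hφc
    simp_rw [fracLaplacian_eq_singularIntegral h0 h2 hφ hφc, mul_left_comm (u _)] at h
    rw [integral_const_mul] at h
    exact (mul_eq_zero.1 h).resolve_left (half_pos (normConst_pos hn h0 h2)).ne'

end Euclidean

/-! ### The Fourier symbol -/

section Symbol

open scoped FourierTransform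

variable {E : Type*} [NormedAddCommGroup E] [InnerProductSpace ℝ E]

theorem two_sub_two_mul_cos_nonneg (t : ℝ) : 0 ≤ 2 - 2 * Real.cos t := by
  linarith [Real.cos_le_one t]

theorem two_sub_two_mul_cos_inner_le (ξ y : E) :
    2 - 2 * Real.cos (2 * Real.pi * inner ℝ ξ y) ≤
      (4 + (2 * Real.pi * ‖ξ‖) ^ 2) * min 1 (‖y‖ ^ 2) := by
  have hpi := Real.pi_pos
  set t := 2 * Real.pi * inner ℝ ξ y with ht
  have h4 : 2 - 2 * Real.cos t ≤ 4 := by linarith [Real.neg_one_le_cos t]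
  have hsq : 2 - 2 * Real.cos t ≤ t ^ 2 := by linarith [Real.one_sub_sq_div_two_le_cos (x := t)]
  have ht2 : t ^ 2 ≤ (2 * Real.pi * ‖ξ‖) ^ 2 * ‖y‖ ^ 2 := by
    rw [← mul_pow, ← sq_abs]
    refine pow_le_pow_left₀ (abs_nonneg _) ?_ 2
    rw [ht, abs_mul, abs_of_pos (by positivity), mul_assoc (2 * Real.pi)]
    exact mul_le_mul_of_nonneg_left (abs_real_inner_le_norm ξ y) (by positivity)
  have hx : 0 ≤ (2 * Real.pi * ‖ξ‖) ^ 2 := by positivity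
  rcases le_total 1 (‖y‖ ^ 2) with h | h
  · rw [min_eq_left h]; linarith
  · rw [min_eq_right h]; nlinarith [sq_nonneg ‖y‖]

theorem norm_symbol_integrand_le (s : ℝ) (ξ y : E) :
    ‖(‖y‖ ^ s)⁻¹ * (2 - 2 * Real.cos (2 * Real.pi * inner ℝ ξ y))‖ ≤
      ((‖y‖ ^ s)⁻¹ * min 1 (‖y‖ ^ 2)) * (4 + (2 * Real.pi * ‖ξ‖) ^ 2) := by
  have hk : 0 ≤ (‖y‖ ^ s)⁻¹ := by positivity
  rw [Real.norm_of_nonneg (mul_nonneg hk (two_sub_two_mul_cos_nonneg _)),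
    mul_assoc (‖y‖ ^ s)⁻¹, mul_comm (min _ _)]
  exact mul_le_mul_of_nonneg_left (two_sub_two_mul_cos_inner_le ξ y) hk

variable [FiniteDimensional ℝ E] [MeasurableSpace E] [BorelSpace E] {α : ℝ}

/-- The Fourier symbol of `singularIntegral s`. -/
def symbol (s : ℝ) (ξ : E) : ℝ :=
  ∫ y : E, (‖y‖ ^ s)⁻¹ * (2 - 2 * Real.cos (2 * Real.pi * inner ℝ ξ y))

theorem integrable_symbol_integrand [Nontrivial E] (h0 : 0 < α) (h2 : α < 2) (ξ : E) :
    Integrable (fun y : E => (‖y‖ ^ ((Module.finrank ℝ E : ℝ) + α))⁻¹ *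
      (2 - 2 * Real.cos (2 * Real.pi * inner ℝ ξ y))) := by
  refine ((integrable_min_kernel h0 h2).mul_const (4 + (2 * Real.pi * ‖ξ‖) ^ 2)).mono' ?_
    (Eventually.of_forall fun y => norm_symbol_integrand_le _ ξ y)
  have : Measurable (fun y : E => (‖y‖ ^ ((Module.finrank ℝ E : ℝ) + α))⁻¹ *
      (2 - 2 * Real.cos (2 * Real.pi * inner ℝ ξ y))) := by fun_prop
  exact this.aestronglyMeasurable

/-- Reflection in the hyperplane orthogonal to ξ - η sends ξ to η and preserves measure, norm and
inner product. -/
theorem symbol_eq_of_norm_eq (s : ℝ) {ξ η : E} (h : ‖ξ‖ = ‖η‖) : symbol s ξ = symbol s η := by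
  set ρ := (Submodule.span ℝ {ξ - η})ᗮ.reflection
  have hρ : ρ ξ = η := Submodule.reflection_sub h
  unfold symbol
  rw [← ρ.measurePreserving.integral_comp ρ.toHomeomorph.measurableEmbedding
    (fun y : E => (‖y‖ ^ s)⁻¹ * (2 - 2 * Real.cos (2 * Real.pi * inner ℝ η y)))]
  congr 1 with y
  rw [← hρ, ρ.norm_map, ρ.inner_map_map]

theorem symbol_smul (ξ : E) {t : ℝ} (ht : 0 < t) :
    symbol (Module.finrank ℝ E + α) (t • ξ) =
      t ^ α * symbol (Module.finrank ℝ E + α) ξ := by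
  unfold symbol
  set s := (Module.finrank ℝ E : ℝ) + α with hs
  have h := Measure.integral_comp_smul volume
    (fun y : E => (‖y‖ ^ s)⁻¹ * (2 - 2 * Real.cos (2 * Real.pi * inner ℝ ξ y))) t
  have e : (fun y : E => (‖y‖ ^ s)⁻¹ * (2 - 2 * Real.cos (2 * Real.pi * inner ℝ (t • ξ) y))) =
      fun y => t ^ s * ((‖t • y‖ ^ s)⁻¹ *
        (2 - 2 * Real.cos (2 * Real.pi * inner ℝ ξ (t • y)))) := by
    ext y
    have h1 : t ^ s ≠ 0 := (Real.rpow_pos_of_pos ht s).ne'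
    rw [norm_smul, Real.norm_of_nonneg ht.le, Real.mul_rpow ht.le (norm_nonneg y), mul_inv,
      real_inner_smul_left, real_inner_smul_right, ← mul_assoc (t ^ s), mul_inv_cancel_left₀ h1]
  rw [e, integral_const_mul, h, smul_eq_mul, abs_of_pos (by positivity), ← mul_assoc]
  congr 1
  rw [hs, Real.rpow_add ht, Real.rpow_natCast]
  field_simp

theorem symbol_pos [Nontrivial E] (h0 : 0 < α) (h2 : α < 2) {ξ : E} (hξ : ξ ≠ 0) :
    0 < symbol (Module.finrank ℝ E + α) ξ := by
  unfold symbol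
  rw [integral_pos_iff_support_of_nonneg
    (fun y => mul_nonneg (by positivity) (two_sub_two_mul_cos_nonneg _))
    (integrable_symbol_integrand h0 h2 ξ)]
  have hopen : IsOpen {y : E | Real.cos (2 * Real.pi * inner ℝ ξ y) < 1} :=
    isOpen_lt (by fun_prop) continuous_const
  have hne : {y : E | Real.cos (2 * Real.pi * inner ℝ ξ y) < 1}.Nonempty := by
    -- At this point the phase is π/2, where the cosine is 0.
    refine ⟨(4 * ‖ξ‖ ^ 2)⁻¹ • ξ, ?_⟩
    have hn : ‖ξ‖ ^ 2 ≠ 0 := by simpa using hξ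
    have : 2 * Real.pi * inner ℝ ξ ((4 * ‖ξ‖ ^ 2)⁻¹ • ξ) = Real.pi / 2 := by
      rw [real_inner_smul_right, real_inner_self_eq_norm_sq]
      field_simp
      norm_num
    change Real.cos _ < 1
    rw [this, Real.cos_pi_div_two]
    exact one_pos
  refine (hopen.measure_pos volume hne).trans_le (measure_mono fun y hy => ?_)
  have hy' : Real.cos (2 * Real.pi * inner ℝ ξ y) < 1 := hy
  have hy0 : y ≠ 0 := by
    rintro rfl
    simp at hy'
  have hny : 0 < ‖y‖ := norm_pos_iff.2 hy0
  have h3 : 0 < 2 - 2 * Real.cos (2 * Real.pi * inner ℝ ξ y) := by linarith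
  exact (mul_pos (by positivity) h3).ne'

theorem exists_symbol_eq [Nontrivial E] (h0 : 0 < α) (h2 : α < 2) :
    ∃ c > 0, ∀ ξ : E, symbol (Module.finrank ℝ E + α) ξ = c * ‖ξ‖ ^ α := by
  obtain ⟨e, he⟩ := exists_norm_eq E zero_le_one
  have he0 : e ≠ 0 := by rintro rfl; simp at he
  refine ⟨_, symbol_pos h0 h2 he0, fun ξ => ?_⟩
  rcases eq_or_ne ξ 0 with rfl | hξ
  · simp [symbol, h0.ne']
  · have hn : 0 < ‖ξ‖ := norm_pos_iff.2 hξ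
    rw [symbol_eq_of_norm_eq _ (η := ‖ξ‖ • e) (by rw [norm_smul, he]; simp), symbol_smul e hn,
      mul_comm]

theorem symmDiff₂_fourierInv (g : SchwartzMap E ℂ) (x y : E) :
    symmDiff₂ (𝓕⁻ (g : E → ℂ)) x y =
      ∫ v : E, (2 - 2 * Real.cos (2 * Real.pi * inner ℝ v y)) •
        (Complex.exp (↑(2 * Real.pi * inner ℝ v x) * Complex.I) • g v) := by
  let G : E → E → ℂ := fun z v => Complex.exp (↑(2 * Real.pi * inner ℝ v z) * Complex.I) • g v
  have hint : ∀ z : E, Integrable (G z) := by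
    intro z
    have hc : Continuous (fun v : E =>
        Complex.exp (↑(2 * Real.pi * inner ℝ v z) * Complex.I) • g v) := by fun_prop
    refine (g.integrable (μ := volume)).norm.mono' hc.aestronglyMeasurable
      (Eventually.of_forall fun v => ?_)
    rw [norm_smul, Complex.norm_exp_ofReal_mul_I, one_mul]
  simp only [symmDiff₂, Real.fourierInv_eq']
  change (∫ v, G x v) + (∫ v, G x v) - (∫ v, G (x + y) v) - ∫ v, G (x - y) v = _
  rw [← integral_add (hint _) (hint _),
    ← integral_sub (f := fun v => G x v + G x v) ((hint _).add (hint _)) (hint _),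
    ← integral_sub (f := fun v => G x v + G x v - G (x + y) v)
      (((hint _).add (hint _)).sub (hint _)) (hint _)]
  congr 1 with v
  simp only [G]
  simp only [smul_eq_mul, Complex.real_smul, inner_add_right, inner_sub_right]
  push_cast
  rw [Complex.cos, show (2 * (Real.pi : ℂ) * ((inner ℝ v x : ℝ) + (inner ℝ v y : ℝ)) * Complex.I) =
    2 * Real.pi * (inner ℝ v x : ℝ) * Complex.I + 2 * Real.pi * (inner ℝ v y : ℝ) * Complex.I by ring,
    show (2 * (Real.pi : ℂ) * ((inner ℝ v x : ℝ) - (inner ℝ v y : ℝ)) * Complex.I) =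
    2 * Real.pi * (inner ℝ v x : ℝ) * Complex.I + -(2 * Real.pi * (inner ℝ v y : ℝ)) * Complex.I
    by ring, Complex.exp_add, Complex.exp_add]
  ring

/-- On the Fourier side a symmetric difference multiplies by 2 - 2cos(2π⟨v, y⟩), and Fubini
integrates this factor against the kernel. It is at most (4 + (2π‖v‖)²) min(1, ‖y‖²), so
integrability on the product reduces to moments of g. -/
theorem singularIntegral_fourierInv [Nontrivial E] (h0 : 0 < α) (h2 : α < 2)
    (g : SchwartzMap E ℂ) (x : E) :
    singularIntegral (Module.finrank ℝ E + α) (𝓕⁻ (g : E → ℂ)) x =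
      𝓕⁻ (fun v => symbol (Module.finrank ℝ E + α) v • g v) x := by
  set s := (Module.finrank ℝ E : ℝ) + α with hs
  have hg : Integrable (fun v => (4 + (2 * Real.pi * ‖v‖) ^ 2) * ‖g v‖) := by
    have h1 := (g.integrable_pow_mul volume 0).const_mul 4
    have h3 := (g.integrable_pow_mul volume 2).const_mul ((2 * Real.pi) ^ 2)
    refine (h1.add h3).congr (Eventually.of_forall fun v => ?_)
    simp only [Pi.add_apply]
    ring
  have hm : Measurable (fun p : E × E => (‖p.1‖ ^ s)⁻¹ *
      (2 - 2 * Real.cos (2 * Real.pi * inner ℝ p.2 p.1))) := by fun_prop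
  have hc : Continuous (fun p : E × E =>
      Complex.exp (↑(2 * Real.pi * inner ℝ p.2 x) * Complex.I) • g p.2) := by fun_prop
  have hprod : Integrable (fun p : E × E => ((‖p.1‖ ^ s)⁻¹ *
      (2 - 2 * Real.cos (2 * Real.pi * inner ℝ p.2 p.1))) •
        (Complex.exp (↑(2 * Real.pi * inner ℝ p.2 x) * Complex.I) • g p.2))
      ((volume : Measure E).prod volume) := by
    refine ((integrable_min_kernel (E := E) h0 h2).mul_prod hg).mono'
      (hm.aestronglyMeasurable.smul hc.aestronglyMeasurable) (Eventually.of_forall fun p => ?_)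
    rw [norm_smul, norm_smul, Complex.norm_exp_ofReal_mul_I, one_mul, ← mul_assoc]
    exact mul_le_mul_of_nonneg_right (norm_symbol_integrand_le s p.2 p.1) (norm_nonneg _)
  have hswap := integral_integral_swap (f := fun y v => ((‖y‖ ^ s)⁻¹ *
      (2 - 2 * Real.cos (2 * Real.pi * inner ℝ v y))) •
        (Complex.exp (↑(2 * Real.pi * inner ℝ v x) * Complex.I) • g v)) hprod
  unfold singularIntegral
  simp_rw [symmDiff₂_fourierInv, ← integral_smul, ← mul_smul (_ : ℝ) (_ : ℝ) (_ : ℂ)]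
  rw [hswap, Real.fourierInv_eq']
  congr 1 with v
  rw [integral_smul_const, smul_comm]
  rfl

end Symbol

/-! ### The spectrum is contained in the origin -/

section FourierTest

open scoped FourierTransform

variable {E : Type*} [NormedAddCommGroup E] [InnerProductSpace ℝ E] [FiniteDimensional ℝ E]
  [MeasurableSpace E] [BorelSpace E] {α : ℝ} {u : E → ℝ}

/-- Away from 0 the symbol is smooth and nonzero, so h divided by it is again a test function g.
Applying harmonicity to the Schwartz function 𝓕⁻ g restores h under the inverse transform. -/
theorem WeakHarmonic.integral_fourierInv_eq_zero [Nontrivial E] (h0 : 0 < α) (h2 : α < 2)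
    (hu : WeakHarmonic α u) {h : E → ℂ} (hs : ContDiff ℝ ∞ h) (hc : HasCompactSupport h)
    (hz : h =ᶠ[𝓝 0] 0) : ∫ x, u x • 𝓕⁻ h x = 0 := by
  obtain ⟨c, hc0, hsym⟩ := exists_symbol_eq (E := E) h0 h2
  have hsmooth : ContDiff ℝ ∞ (fun ξ : E => (c * ‖ξ‖ ^ α)⁻¹ • h ξ) := by
    rw [contDiff_iff_contDiffAt]
    intro ξ
    rcases eq_or_ne ξ 0 with rfl | hξ
    · refine (contDiffAt_const (c := (0 : ℂ))).congr_of_eventuallyEq ?_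
      filter_upwards [hz] with ξ hξ
      simp [hξ]
    · have hn : 0 < ‖ξ‖ := norm_pos_iff.2 hξ
      have h1 : ContDiffAt ℝ ∞ (fun ξ : E => c * ‖ξ‖ ^ α) ξ :=
        contDiffAt_const.mul ((contDiffAt_norm ℝ hξ).rpow_const_of_ne hn.ne')
      have h3 : ContDiffAt ℝ ∞ (fun ξ : E => (c * ‖ξ‖ ^ α)⁻¹) ξ := h1.inv (by positivity)
      exact h3.smul hs.contDiffAt
  have hcomp : HasCompactSupport (fun ξ : E => (c * ‖ξ‖ ^ α)⁻¹ • h ξ) :=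
    hc.smul_left (f := fun ξ : E => (c * ‖ξ‖ ^ α)⁻¹)
  obtain ⟨g, hg⟩ : ∃ g : SchwartzMap E ℂ, ∀ v, g v = (c * ‖v‖ ^ α)⁻¹ • h v :=
    ⟨hcomp.toSchwartzMap hsmooth, fun _ => rfl⟩
  have key : (fun v => symbol (Module.finrank ℝ E + α) v • g v) = h := by
    ext v
    rw [hg]
    rcases eq_or_ne v 0 with rfl | hv
    · have : h 0 = 0 := hz.self_of_nhds
      simp [this]
    · have := norm_pos_iff.2 hv
      rw [hsym, smul_smul, mul_inv_cancel₀ (by positivity), one_smul]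
  have h := hu.integral_eq_zero_of_schwartz h0 h2 (𝓕⁻ g)
  rw [SchwartzMap.fourierInv_coe] at h
  simpa only [singularIntegral_fourierInv h0 h2, key] using h

end FourierTest

/-! ### Scale-invariant averages and their low-frequency limit -/

section Dilation

open scoped FourierTransform

variable {E : Type*} [NormedAddCommGroup E] [InnerProductSpace ℝ E]

/-- The `L¹`-normalised dilation `z ↦ R ^ d * k (R z)`. -/
def dilate (k : E → ℂ) (R : ℝ) (z : E) : ℂ := (R ^ Module.finrank ℝ E) • k (R • z)

theorem dilate_one (k : E → ℂ) : dilate k 1 = k := by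
  ext z; simp [dilate]

theorem continuous_dilate {k : E → ℂ} (hk : Continuous k) (R : ℝ) : Continuous (dilate k R) := by
  unfold dilate; fun_prop

theorem weight_smul_le_of_pos {s R : ℝ} (hs : 0 ≤ s) (hR : 0 < R) (x : E) :
    weight s (R • x) ≤ max 1 (R ^ (-s)) * weight s x := by
  rcases le_total R 1 with h | h
  · exact (weight_smul_le hs hR h x).trans
      (mul_le_mul_of_nonneg_right (le_max_right _ _) (weight_pos _ _).le)
  · refine le_trans ?_ (mul_le_mul_of_nonneg_right (le_max_left _ _) (weight_pos _ _).le)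
    rw [one_mul]
    refine Real.rpow_le_rpow_of_nonpos (by positivity) ?_ (by linarith)
    rw [norm_smul, Real.norm_of_nonneg hR.le]
    nlinarith [norm_nonneg x]

theorem exists_norm_dilate_sub_le [FiniteDimensional ℝ E] (k : SchwartzMap E ℂ) {s R : ℝ}
    (hs : 0 ≤ s) (hR : 0 < R) :
    ∃ C, 0 ≤ C ∧ ∀ x y, ‖dilate k R (y - x)‖ ≤ C * (1 + ‖x‖) ^ s * weight s y := by
  obtain ⟨A, hA, h⟩ := exists_norm_iteratedFDeriv_le_weight k s 0
  refine ⟨R ^ Module.finrank ℝ E * (A * max 1 (R ^ (-s))), by positivity, fun x y => ?_⟩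
  have h1 : ‖k (R • (y - x))‖ ≤ A * weight s (R • (y - x)) := by
    simpa using h 0 le_rfl (R • (y - x))
  have h2 := weight_smul_le_of_pos hs hR (y - x)
  have h3 := weight_sub_le hs y x
  unfold dilate
  rw [norm_smul, Real.norm_of_nonneg (by positivity)]
  calc _ ≤ R ^ Module.finrank ℝ E * (A * (max 1 (R ^ (-s)) *
        ((1 + ‖x‖) ^ s * weight s y))) := by
        refine mul_le_mul_of_nonneg_left (h1.trans (mul_le_mul_of_nonneg_left (h2.trans ?_) hA))
          (by positivity)
        exact mul_le_mul_of_nonneg_left h3 (by positivity)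
    _ = _ := by ring

theorem contDiff_modulate_dilate {θ : E → ℂ} (hθs : ContDiff ℝ ∞ θ) (hθc : HasCompactSupport θ)
    {R : ℝ} (hR : 0 < R) (x : E) :
    ContDiff ℝ ∞ (fun ξ : E =>
      Complex.exp (↑(-2 * Real.pi * inner ℝ ξ x) * Complex.I) • θ (R⁻¹ • ξ)) ∧
    HasCompactSupport (fun ξ : E =>
      Complex.exp (↑(-2 * Real.pi * inner ℝ ξ x) * Complex.I) • θ (R⁻¹ • ξ)) := by
  constructor
  · have h1 : ContDiff ℝ ∞ (fun ξ : E => (-2 * Real.pi * inner ℝ ξ x : ℝ)) :=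
      contDiff_const.mul (contDiff_id.inner ℝ contDiff_const)
    have h3 : ContDiff ℝ ∞ (fun ξ : E => ((-2 * Real.pi * inner ℝ ξ x : ℝ) : ℂ)) :=
      Complex.ofRealCLM.contDiff.comp h1
    exact (h3.mul contDiff_const).cexp.smul (hθs.comp (contDiff_const_smul R⁻¹))
  · have h4 : HasCompactSupport (fun ξ : E => θ (R⁻¹ • ξ)) :=
      hθc.comp_homeomorph (Homeomorph.smulOfNeZero R⁻¹ (inv_ne_zero hR.ne'))
    refine h4.mono fun ξ hξ hz => hξ ?_
    have hz' : θ (R⁻¹ • ξ) = 0 := hz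
    change _ • θ (R⁻¹ • ξ) = 0
    rw [hz', smul_zero]

variable [FiniteDimensional ℝ E] [MeasurableSpace E] [BorelSpace E]

theorem fourierInv_sub_apply (f g : SchwartzMap E ℂ) (y : E) :
    𝓕⁻ (fun ξ => f ξ - g ξ) y = 𝓕⁻ (f : E → ℂ) y - 𝓕⁻ (g : E → ℂ) y := by
  have h : 𝓕⁻ (f - g) = 𝓕⁻ f - 𝓕⁻ g :=
    map_sub (FourierTransform.fourierInvCLM ℂ (SchwartzMap E ℂ)) f g
  change 𝓕⁻ ((f - g : SchwartzMap E ℂ) : E → ℂ) y = _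
  rw [← SchwartzMap.fourierInv_coe, h, ← SchwartzMap.fourierInv_coe, ← SchwartzMap.fourierInv_coe]
  rfl

theorem fourierInv_modulate_dilate (θ : E → ℂ) {R : ℝ} (hR : 0 < R) (x y : E) :
    𝓕⁻ (fun ξ : E => Complex.exp (↑(-2 * Real.pi * inner ℝ ξ x) * Complex.I) • θ (R⁻¹ • ξ)) y =
      dilate (𝓕⁻ θ) R (y - x) := by
  unfold dilate
  rw [Real.fourierInv_eq', Real.fourierInv_eq']
  have h := Measure.integral_comp_smul (volume : Measure E) (fun w : E =>
    Complex.exp (↑(2 * Real.pi * inner ℝ w (R • (y - x))) * Complex.I) • θ w) R⁻¹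
  rw [inv_pow, inv_inv, abs_of_pos (by positivity)] at h
  rw [← h]
  congr 1 with v
  rw [smul_smul, ← Complex.exp_add, real_inner_smul_left, real_inner_smul_right,
    inv_mul_cancel_left₀ hR.ne', inner_sub_right]
  congr 2
  push_cast
  ring

variable {α : ℝ} {u : E → ℝ}

theorem WeakHarmonic.integrable_smul_dilate (hα : 0 ≤ α) (hu : WeakHarmonic α u)
    (k : SchwartzMap E ℂ) {R : ℝ} (hR : 0 < R) (x : E) :
    Integrable (fun y => u y • dilate k R (y - x)) := by
  obtain ⟨C, -, hC⟩ := exists_norm_dilate_sub_le k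
    (s := Module.finrank ℝ E + α) (by positivity) hR
  exact hu.integrable_smul (Continuous.aestronglyMeasurable
    ((continuous_dilate k.continuous R).comp (continuous_sub_right x))) (hC x)

/-- There is a Schwartz function of integral one whose averages of a weakly harmonic function do
not depend on the scale. -/
theorem WeakHarmonic.exists_scale_invariant_kernel [Nontrivial E] (h0 : 0 < α) (h2 : α < 2)
    (hu : WeakHarmonic α u) :
    ∃ k : SchwartzMap E ℂ, ∫ z, k z = 1 ∧ ∀ R : ℝ, 0 < R → ∀ x,
      ∫ y, u y • dilate k R (y - x) = ∫ y, u y • k (y - x) := by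
  let χ : ContDiffBump (0 : E) := ⟨1, 2, one_pos, one_lt_two⟩
  obtain ⟨θ, hθs, hθc, hθ1⟩ : ∃ θ : E → ℂ, ContDiff ℝ ∞ θ ∧ HasCompactSupport θ ∧
      θ =ᶠ[𝓝 0] 1 := by
    refine ⟨fun x => (χ x : ℂ), Complex.ofRealCLM.contDiff.comp χ.contDiff,
      χ.hasCompactSupport.comp_left Complex.ofReal_zero, ?_⟩
    filter_upwards [χ.eventuallyEq_one] with x hx
    simp [hx]
  obtain ⟨Θ, hΘ⟩ : ∃ Θ : SchwartzMap E ℂ, (Θ : E → ℂ) = θ :=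
    ⟨hθc.toSchwartzMap hθs, rfl⟩
  have hk : ((𝓕⁻ Θ : SchwartzMap E ℂ) : E → ℂ) = 𝓕⁻ θ := by
    rw [SchwartzMap.fourierInv_coe, hΘ]
  refine ⟨𝓕⁻ Θ, ?_, fun R hR x => ?_⟩
  -- The integral of the kernel is its Fourier transform at 0, namely θ 0 = 1.
  · have h : 𝓕 (𝓕⁻ Θ) = Θ := FourierTransform.fourier_fourierInv_eq Θ
    have h1 : 𝓕 ((𝓕⁻ Θ : SchwartzMap E ℂ) : E → ℂ) 0 = Θ 0 := by
      rw [← SchwartzMap.fourier_coe, h]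
    rw [Real.fourier_eq', hΘ, hθ1.self_of_nhds] at h1
    simpa using h1
  · have h1 := contDiff_modulate_dilate hθs hθc hR x
    have h3 := contDiff_modulate_dilate hθs hθc one_pos x
    -- Near ξ = 0 both cut-offs equal 1, so the modulated functions coincide there.
    have hz := hu.integral_fourierInv_eq_zero h0 h2 (h1.1.sub h3.1) (h1.2.sub h3.2) (by
      have e : ∀ R : ℝ, ∀ᶠ ξ : E in 𝓝 0, θ (R⁻¹ • ξ) = 1 := by
        intro R
        have ht : Tendsto (fun ξ : E => R⁻¹ • ξ) (𝓝 0) (𝓝 0) := by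
          simpa using (continuous_const_smul (R⁻¹)).tendsto (0 : E)
        exact ht.eventually hθ1
      filter_upwards [e R, e 1] with ξ ha hb
      rw [ha, hb, sub_self]
      rfl)
    have hdiff : ∀ y, 𝓕⁻ (fun ξ : E =>
        Complex.exp (↑(-2 * Real.pi * inner ℝ ξ x) * Complex.I) • θ (R⁻¹ • ξ) -
        Complex.exp (↑(-2 * Real.pi * inner ℝ ξ x) * Complex.I) • θ ((1 : ℝ)⁻¹ • ξ)) y =
        dilate (𝓕⁻ Θ : SchwartzMap E ℂ) R (y - x) - (𝓕⁻ Θ : SchwartzMap E ℂ) (y - x) := by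
      intro y
      rw [← dilate_one ((𝓕⁻ Θ : SchwartzMap E ℂ) : E → ℂ), hk, dilate_one,
        ← fourierInv_modulate_dilate θ hR x y]
      conv_rhs => rw [← dilate_one (𝓕⁻ θ), ← fourierInv_modulate_dilate θ one_pos x y]
      exact fourierInv_sub_apply (h1.2.toSchwartzMap h1.1) (h3.2.toSchwartzMap h3.1) y
    simp_rw [hdiff, smul_sub] at hz
    have i1 := hu.integrable_smul_dilate h0.le (𝓕⁻ Θ) hR x
    have i3 := hu.integrable_smul_dilate h0.le (𝓕⁻ Θ) one_pos x
    rw [dilate_one] at i3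
    rw [integral_sub i1 i3] at hz
    exact sub_eq_zero.1 hz

/-- Averages against kernels concentrated at low frequencies vanish in the limit. -/
theorem WeakHarmonic.tendsto_integral_dilate_zero (hα : 0 ≤ α) (hu : WeakHarmonic α u) {m : ℕ}
    (hm : α ≤ m) (hm0 : m ≠ 0) {q : ℝ → E → ℂ} (hqc : ∀ R, Continuous (q R)) {C : ℝ} (hC : 0 ≤ C)
    (hq : ∀ R, 0 < R → R ≤ 1 → ∀ z, ‖q R z‖ ≤
      C * (R ^ Module.finrank ℝ E * R ^ m * weight (Module.finrank ℝ E + α) (R • z))) (x : E) :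
    Tendsto (fun R => ∫ y, u y • q R (y - x)) (𝓝[>] 0) (𝓝 0) := by
  set s := (Module.finrank ℝ E : ℝ) + α with hs
  have hs0 : 0 ≤ s := by positivity
  have hsmall : ∀ᶠ R : ℝ in 𝓝[>] 0, 0 < R ∧ R ≤ 1 := by
    filter_upwards [self_mem_nhdsWithin, nhdsWithin_le_nhds (eventually_le_nhds one_pos)]
      with R h1 h3 using ⟨h1, h3⟩
  have hlim := hu.tendsto_integral (l := 𝓝[>] (0 : ℝ)) (g := fun R y => q R (y - x))
    (g' := fun _ => 0) (C := C * (1 + ‖x‖) ^ s)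
    (fun R => ((hqc R).comp (continuous_sub_right x)).aestronglyMeasurable) ?_ ?_
  · simpa using hlim
  · filter_upwards [hsmall] with R ⟨hR, hR1⟩ y
    -- The total exponent is m - α ≥ 0. At α = m this gives only domination; the pointwise limit
    -- comes from R ^ m ≤ R below.
    have h3 : R ^ Module.finrank ℝ E * R ^ m * R ^ (-s) ≤ 1 := by
      rw [← Real.rpow_natCast, ← Real.rpow_natCast, ← Real.rpow_add hR, ← Real.rpow_add hR]
      exact Real.rpow_le_one hR.le hR1 (by rw [hs]; linarith)
    calc ‖q R (y - x)‖ ≤ C * (R ^ Module.finrank ℝ E * R ^ m * weight s (R • (y - x))) :=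
          hq R hR hR1 (y - x)
      _ ≤ C * (R ^ Module.finrank ℝ E * R ^ m * (R ^ (-s) * weight s (y - x))) := by
          gcongr; exact weight_smul_le hs0 hR hR1 _
      _ = C * ((R ^ Module.finrank ℝ E * R ^ m * R ^ (-s)) * weight s (y - x)) := by ring
      _ ≤ C * (1 * ((1 + ‖x‖) ^ s * weight s y)) := by
          have := (weight_pos s (y - x)).le
          gcongr
          exact weight_sub_le hs0 y x
      _ = _ := by ring
  · intro y
    have hb : Tendsto (fun R : ℝ => C * R) (𝓝[>] 0) (𝓝 0) := by
      simpa using (tendsto_id.const_mul C).mono_left (nhdsWithin_le_nhds (a := (0 : ℝ)))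
    refine squeeze_zero_norm' ?_ hb
    filter_upwards [hsmall] with R ⟨hR, hR1⟩
    refine (hq R hR hR1 (y - x)).trans (mul_le_mul_of_nonneg_left ?_ hC)
    have h1 : R ^ Module.finrank ℝ E ≤ 1 := pow_le_one₀ hR.le hR1
    have h3 : R ^ m ≤ R := pow_le_of_le_one hR.le hR1 hm0
    have hw := weight_le_one hs0 (R • (y - x))
    have hw0 := (weight_pos s (R • (y - x))).le
    calc _ ≤ 1 * R * 1 := by gcongr
      _ = R := by ring

variable {k : SchwartzMap E ℂ}

/-- By scale invariance the difference may be computed with the kernel dilated by R → 0. There the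
steps become R • a and R • b, which gains R^2, and α < 2. -/
theorem WeakHarmonic.second_difference_eq_zero (h0 : 0 < α) (h2 : α < 2) (hu : WeakHarmonic α u)
    (hk : ∀ R : ℝ, 0 < R → ∀ x, ∫ y, u y • dilate k R (y - x) = ∫ y, u y • k (y - x))
    (x a b : E) :
    (∫ y, u y • k (y - (x + a + b))) - (∫ y, u y • k (y - (x + a))) -
      (∫ y, u y • k (y - (x + b))) + (∫ y, u y • k (y - x)) = 0 := by
  set s := (Module.finrank ℝ E : ℝ) + α with hs
  have hs0 : 0 ≤ s := by positivity
  obtain ⟨A, hA, h⟩ := exists_norm_iteratedFDeriv_le_weight k s 2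
  let q : ℝ → E → ℂ := fun R z => dilate k R (z - a - b) - dilate k R (z - a) -
    dilate k R (z - b) + dilate k R z
  have hc := fun R => continuous_dilate k.continuous R
  have hlim := hu.tendsto_integral_dilate_zero h0.le (m := 2) (by exact_mod_cast h2.le) two_ne_zero
    (q := q) (C := A * ((1 + ‖a‖) ^ s * (1 + ‖b‖) ^ s * ‖a‖ * ‖b‖)) (fun R => by
      have := hc R
      simp only [q]; fun_prop) (by positivity) (fun R hR hR1 z => ?_) x
  · refine tendsto_nhds_unique (tendsto_const_nhds.congr' ?_) hlim
    filter_upwards [self_mem_nhdsWithin] with R hR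
    have i := fun x => hu.integrable_smul_dilate h0.le k hR x
    rw [← hk R hR, ← hk R hR, ← hk R hR, ← hk R hR, ← integral_sub (i _) (i _),
      ← integral_sub (f := fun y => u y • dilate k R (y - (x + a + b)) -
        u y • dilate k R (y - (x + a))) ((i _).sub (i _)) (i _),
      ← integral_add (f := fun y => u y • dilate k R (y - (x + a + b)) -
        u y • dilate k R (y - (x + a)) - u y • dilate k R (y - (x + b)))
        (((i _).sub (i _)).sub (i _)) (i _)]
    congr 1 with y
    simp only [q, ← smul_sub, ← smul_add, sub_sub, ← add_assoc]
  · have hd := norm_second_difference_le hs0 hA (k.smooth 2) (h 2 le_rfl) (R • z) (-(R • a))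
      (-(R • b))
    have e : q R z = (R ^ Module.finrank ℝ E) • (k (R • z + -(R • a) + -(R • b)) -
        k (R • z + -(R • a)) - k (R • z + -(R • b)) + k (R • z)) := by
      simp only [q, dilate, smul_add, sub_eq_add_neg, smul_neg]
    have hn : ∀ c : E, ‖R • c‖ = R * ‖c‖ := fun c => by
      rw [norm_smul, Real.norm_of_nonneg hR.le]
    rw [norm_neg, norm_neg, hn, hn] at hd
    rw [e, norm_smul, Real.norm_of_nonneg (by positivity)]
    have hw := (weight_pos s (R • z)).le
    have hle : ∀ c : E, (1 + R * ‖c‖) ^ s ≤ (1 + ‖c‖) ^ s := fun c =>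
      Real.rpow_le_rpow (by positivity) (by nlinarith [norm_nonneg c]) hs0
    calc _ ≤ R ^ Module.finrank ℝ E * (A * ((1 + R * ‖a‖) ^ s * (1 + R * ‖b‖) ^ s *
          (R * ‖a‖) * (R * ‖b‖)) * weight s (R • z)) := by gcongr
      _ ≤ R ^ Module.finrank ℝ E * (A * ((1 + ‖a‖) ^ s * (1 + ‖b‖) ^ s *
          (R * ‖a‖) * (R * ‖b‖)) * weight s (R • z)) := by
          have ha := hle a
          have hb := hle b
          gcongr
      _ = _ := by ring

/-- A single difference gains one factor R, which suffices for domination when α ≤ 1. -/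
theorem WeakHarmonic.first_difference_eq_zero (h0 : 0 < α) (h1 : α ≤ 1) (hu : WeakHarmonic α u)
    (hk : ∀ R : ℝ, 0 < R → ∀ x, ∫ y, u y • dilate k R (y - x) = ∫ y, u y • k (y - x))
    (x a : E) :
    (∫ y, u y • k (y - (x + a))) - (∫ y, u y • k (y - x)) = 0 := by
  set s := (Module.finrank ℝ E : ℝ) + α with hs
  have hs0 : 0 ≤ s := by positivity
  obtain ⟨A, hA, h⟩ := exists_norm_iteratedFDeriv_le_weight k s 1
  let q : ℝ → E → ℂ := fun R z => dilate k R (z - a) - dilate k R z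
  have hc := fun R => continuous_dilate k.continuous R
  have hlim := hu.tendsto_integral_dilate_zero h0.le (m := 1) (by exact_mod_cast h1) one_ne_zero
    (q := q) (C := A * ((1 + ‖a‖) ^ s * ‖a‖)) (fun R => by
      have := hc R
      simp only [q]; fun_prop) (by positivity) (fun R hR hR1 z => ?_) x
  · refine tendsto_nhds_unique (tendsto_const_nhds.congr' ?_) hlim
    filter_upwards [self_mem_nhdsWithin] with R hR
    have i := fun x => hu.integrable_smul_dilate h0.le k hR x
    rw [← hk R hR, ← hk R hR, ← integral_sub (i _) (i _)]
    congr 1 with y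
    simp only [q, ← smul_sub, sub_sub]
  · have hd := norm_first_difference_le hs0 hA k.differentiable
      (fun z => by
        have := h 1 le_rfl z
        rwa [← zero_add 1, ← norm_iteratedFDeriv_fderiv, norm_iteratedFDeriv_zero] at this)
      (R • z) (-(R • a))
    have e : q R z = (R ^ Module.finrank ℝ E) • (k (R • z + -(R • a)) - k (R • z)) := by
      simp only [q, dilate, sub_eq_add_neg, smul_add, smul_neg]
    rw [norm_neg, norm_smul, Real.norm_of_nonneg hR.le] at hd
    rw [e, norm_smul, Real.norm_of_nonneg (by positivity)]
    have hw := (weight_pos s (R • z)).le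
    have hle : (1 + R * ‖a‖) ^ s ≤ (1 + ‖a‖) ^ s :=
      Real.rpow_le_rpow (by positivity) (by nlinarith [norm_nonneg a]) hs0
    calc _ ≤ R ^ Module.finrank ℝ E * (A * (1 + R * ‖a‖) ^ s * (R * ‖a‖) *
          weight s (R • z)) := by gcongr
      _ ≤ R ^ Module.finrank ℝ E * (A * (1 + ‖a‖) ^ s * (R * ‖a‖) * weight s (R • z)) := by
          gcongr
      _ = _ := by ring

theorem WeakHarmonic.continuous_integral_translate (hα : 0 ≤ α) (hu : WeakHarmonic α u)
    (k : SchwartzMap E ℂ) : Continuous fun x => ∫ y, u y • k (y - x) := by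
  set s := (Module.finrank ℝ E : ℝ) + α with hs
  have hs0 : 0 ≤ s := by positivity
  obtain ⟨C, hC0, hC⟩ := exists_norm_dilate_sub_le k hs0 one_pos
  rw [dilate_one] at hC
  refine continuous_iff_continuousAt.2 fun x => hu.tendsto_integral
    (C := C * (1 + (‖x‖ + 1)) ^ s) (fun x' => Continuous.aestronglyMeasurable (by fun_prop))
    ?_ (fun y => Continuous.tendsto (by fun_prop) x)
  have hnear : ∀ᶠ x' in 𝓝 x, ‖x'‖ ≤ ‖x‖ + 1 :=
    continuous_norm.tendsto x (Iic_mem_nhds (lt_add_one _))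
  filter_upwards [hnear] with x' hx' y
  refine (hC x' y).trans (mul_le_mul_of_nonneg_right ?_ (weight_pos _ _).le)
  gcongr

end Dilation

/-- A continuous function with vanishing second differences is affine. -/
theorem exists_affine_of_second_difference {E : Type*} [NormedAddCommGroup E]
    [InnerProductSpace ℝ E] [FiniteDimensional ℝ E] {F : E → ℝ} (hF : Continuous F)
    (h : ∀ x a b, F (x + a + b) - F (x + a) - F (x + b) + F x = 0) :
    ∃ b : E, ∀ x, F x = inner ℝ b x + F 0 := by
  -- The hypothesis at x = 0 is additivity of F - F 0; continuity upgrades it to real linearity.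
  let g : E →+ ℝ :=
    { toFun := fun x => F x - F 0
      map_zero' := sub_self _
      map_add' := fun a b => by
        have := h 0 a b
        rw [zero_add, zero_add] at this
        linarith }
  let L : E →L[ℝ] ℝ := g.toRealLinearMap (hF.sub continuous_const)
  refine ⟨(InnerProductSpace.toDual ℝ E).symm L, fun x => ?_⟩
  rw [InnerProductSpace.toDual_symm_apply]
  change F x = (F x - F 0) + F 0
  ring

/-! ### Recovering the function from its averages -/

section Identification

variable {E : Type*} [NormedAddCommGroup E] [InnerProductSpace ℝ E] [FiniteDimensional ℝ E]
  [MeasurableSpace E] [BorelSpace E] {α : ℝ} {u : E → ℝ} {k : SchwartzMap E ℂ}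

theorem WeakHarmonic.locallyIntegrable (hu : WeakHarmonic α u) : LocallyIntegrable u := by
  rw [locallyIntegrable_iff]
  intro K hK
  have hc : Continuous (fun x : E => (weight (Module.finrank ℝ E + α) x)⁻¹) :=
    (continuous_weight _).inv₀ fun x => (weight_pos _ x).ne'
  refine ((hu.integrable.integrableOn (s := K)).continuousOn_mul hc.continuousOn hK).congr
    (Eventually.of_forall fun x => ?_)
  have := (weight_pos (Module.finrank ℝ E + α) x).ne'
  field_simp

theorem integral_smul_dilate_sub (φ : E → ℝ) (k : E → ℂ) {R : ℝ} (hR : 0 < R) (y : E) :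
    ∫ x, φ x • dilate k R (y - x) = ∫ z, φ (y - R⁻¹ • z) • k z := by
  have h1 := integral_sub_left_eq_self (fun x => φ x • dilate k R (y - x)) volume y
  have h3 := Measure.integral_comp_smul (volume : Measure E) (fun z => φ (y - R⁻¹ • z) • k z) R
  have hd : 0 < R ^ Module.finrank ℝ E := by positivity
  rw [← h1]
  have e : ∀ x, φ (y - x) • dilate k R (y - (y - x)) =
      (R ^ Module.finrank ℝ E) • (φ (y - R⁻¹ • (R • x)) • k (R • x)) := by
    intro x
    rw [sub_sub_cancel, inv_smul_smul₀ hR.ne', dilate, smul_comm]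
  simp_rw [e]
  rw [integral_smul, h3, abs_of_pos (by positivity), smul_smul, mul_inv_cancel₀ hd.ne', one_smul]

/-- Fubini moves the average onto φ, whose compact support absorbs the factor (1 + ‖x‖)^s from
translating the kernel. -/
theorem WeakHarmonic.integral_smul_average (hα : 0 ≤ α) (hu : WeakHarmonic α u)
    (k : SchwartzMap E ℂ) {φ : E → ℝ} (hφ : Continuous φ) (hφc : HasCompactSupport φ)
    {R : ℝ} (hR : 0 < R) :
    ∫ x, φ x • ∫ y, u y • dilate k R (y - x) = ∫ y, u y • ∫ z, φ (y - R⁻¹ • z) • k z := by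
  set s := (Module.finrank ℝ E : ℝ) + α with hs
  have hs0 : 0 ≤ s := by positivity
  obtain ⟨C, hC0, hC⟩ := exists_norm_dilate_sub_le k hs0 hR
  have hφi : Integrable (fun x : E => (1 + ‖x‖) ^ s * ‖φ x‖) := by
    have h1 : Continuous (fun x : E => (1 + ‖x‖) ^ s) :=
      (continuous_const.add continuous_norm).rpow_const fun x => Or.inr hs0
    exact (h1.mul hφ.norm).integrable_of_hasCompactSupport hφc.norm.mul_left
  have hint : Integrable (Function.uncurry fun x y : E => u y • (φ x • dilate k R (y - x)))
      ((volume : Measure E).prod volume) := by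
    refine ((hφi.const_mul C).mul_prod hu.integrable.norm).mono' ?_
      (Eventually.of_forall fun p => ?_)
    · have hc : Continuous (fun p : E × E => φ p.1 • dilate k R (p.2 - p.1)) := by
        have := continuous_dilate k.continuous R
        fun_prop
      exact (hu.aestronglyMeasurable.comp_snd).smul hc.aestronglyMeasurable
    · change ‖u p.2 • (φ p.1 • dilate k R (p.2 - p.1))‖ ≤ _
      rw [smul_comm, norm_smul]
      refine (mul_le_mul_of_nonneg_left (norm_smul_le_mul_norm_weight (hC p.1 p.2))
        (norm_nonneg _)).trans_eq (by ring)
  have hswap := integral_integral_swap hint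
  simp_rw [← integral_smul_dilate_sub φ k hR, ← integral_smul, ← hswap]
  congr 1 with x
  congr 1 with y
  rw [smul_comm]

/-- Approximate identity acting on φ. Of the decay of k, s units absorb the translation of φ by z
and the rest is integrable in z, leaving a bound by `weight s y` uniform in j. -/
theorem WeakHarmonic.tendsto_integral_mollify (hα : 0 ≤ α) (hu : WeakHarmonic α u)
    (k : SchwartzMap E ℂ) (hk : ∫ z, k z = 1) {φ : E → ℝ} (hφ : ContDiff ℝ ∞ φ)
    (hφc : HasCompactSupport φ) :
    Tendsto (fun j : ℕ => ∫ y, u y • ∫ z, φ (y - ((j : ℝ) + 1)⁻¹ • z) • k z) atTop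
      (𝓝 (∫ y, u y • (φ y : ℂ))) := by
  set s := (Module.finrank ℝ E : ℝ) + α with hs
  have hs0 : 0 ≤ s := by positivity
  obtain ⟨A, hA, hφA⟩ := exists_norm_iteratedFDeriv_le_weight (hφc.toSchwartzMap hφ) s 0
  have hφA' : ∀ z, ‖φ z‖ ≤ A * weight s z := fun z => by simpa using hφA 0 le_rfl z
  obtain ⟨B, hB, hkB⟩ := exists_norm_iteratedFDeriv_le_weight k (s + (Module.finrank ℝ E + 1)) 0
  have hbound : ∀ (j : ℕ) (y z : E), ‖φ (y - ((j : ℝ) + 1)⁻¹ • z) • k z‖ ≤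
      A * weight s y * (B * weight (Module.finrank ℝ E + 1) z) := by
    intro j y z
    have hk' : ‖k z‖ ≤ B * (weight s z * weight (Module.finrank ℝ E + 1) z) := by
      rw [← weight_add]; simpa using hkB 0 le_rfl z
    have hj : ‖((j : ℝ) + 1)⁻¹ • z‖ ≤ ‖z‖ := by
      rw [norm_smul, Real.norm_of_nonneg (by positivity)]
      refine mul_le_of_le_one_left (norm_nonneg z) (inv_le_one_of_one_le₀ ?_)
      linarith [Nat.cast_nonneg (α := ℝ) j]
    have hw := (weight_pos s y).le
    have h1 : weight s (y - ((j : ℝ) + 1)⁻¹ • z) ≤ (1 + ‖z‖) ^ s * weight s y :=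
      (weight_sub_le hs0 y _).trans (by gcongr)
    rw [norm_smul]
    calc _ ≤ (A * ((1 + ‖z‖) ^ s * weight s y)) *
          (B * (weight s z * weight (Module.finrank ℝ E + 1) z)) :=
          mul_le_mul ((hφA' _).trans (mul_le_mul_of_nonneg_left h1 hA)) hk' (norm_nonneg _)
            (by positivity)
      _ = A * weight s y * (B * weight (Module.finrank ℝ E + 1) z) *
          ((1 + ‖z‖) ^ s * weight s z) := by ring
      _ = _ := by rw [rpow_mul_weight, mul_one]
  have hwi : Integrable (weight (Module.finrank ℝ E + 1) : E → ℝ) :=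
    integrable_weight (by linarith)
  refine hu.tendsto_integral (C := A * ∫ z : E, B * weight (Module.finrank ℝ E + 1) z)
    (fun j => ?_) (Eventually.of_forall fun j y => ?_) (fun y => ?_)
  · have hφ' := hφ.continuous
    have hc : Continuous (fun p : E × E => φ (p.1 - ((j : ℝ) + 1)⁻¹ • p.2) • k p.2) := by
      fun_prop
    exact (hc.aestronglyMeasurable (μ := (volume : Measure E).prod volume)).integral_prod_right'
  · refine (norm_integral_le_of_norm_le ((hwi.const_mul B).const_mul _)
      (Eventually.of_forall fun z => hbound j y z)).trans_eq ?_
    rw [integral_const_mul]; ring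
  · have hlim := tendsto_integral_of_dominated_convergence
      (F := fun (j : ℕ) z => φ (y - ((j : ℝ) + 1)⁻¹ • z) • k z) (f := fun z => φ y • k z)
      (fun z => A * weight s y * (B * weight (Module.finrank ℝ E + 1) z))
      (fun j => by
        have hφ' := hφ.continuous
        exact Continuous.aestronglyMeasurable (by fun_prop))
      ((hwi.const_mul B).const_mul _)
      (fun j => Eventually.of_forall fun z => hbound j y z)
      (Eventually.of_forall fun z => by
        have h1 : Tendsto (fun j : ℕ => ((j : ℝ) + 1)⁻¹) atTop (𝓝 0) := by
          simpa only [one_div] using tendsto_one_div_add_atTop_nhds_zero_nat (𝕜 := ℝ)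
        have h3 : Tendsto (fun j : ℕ => y - ((j : ℝ) + 1)⁻¹ • z) atTop (𝓝 y) := by
          simpa using (h1.smul_const z).const_sub y
        exact ((hφ.continuous.tendsto y).comp h3).smul_const (k z))
    rw [integral_smul, hk] at hlim
    simpa only [Complex.real_smul, mul_one] using hlim

/-- A weakly harmonic function agrees almost everywhere with its average against a kernel of
integral one whose averages do not depend on the scale. -/
theorem WeakHarmonic.ae_eq_average (hα : 0 ≤ α) (hu : WeakHarmonic α u) (hk1 : ∫ z, k z = 1)
    (hk : ∀ R : ℝ, 0 < R → ∀ x, ∫ y, u y • dilate k R (y - x) = ∫ y, u y • k (y - x)) :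
    ∀ᵐ x, (u x : ℂ) = ∫ y, u y • k (y - x) := by
  have hul : LocallyIntegrable (fun x => (u x : ℂ)) := by
    rw [locallyIntegrable_iff]
    exact fun K hK => (hu.locallyIntegrable.integrableOn_isCompact hK).ofReal
  refine ae_eq_of_integral_contDiff_smul_eq hul
    (hu.continuous_integral_translate hα k).locallyIntegrable fun φ hφ hφc => ?_
  have h := hu.tendsto_integral_mollify hα k hk1 hφ hφc
  -- Scale invariance makes the mollified pairings constant in j, so they equal their limit.
  have hconst : ∀ j : ℕ, ∫ y, u y • ∫ z, φ (y - ((j : ℝ) + 1)⁻¹ • z) • k z =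
      ∫ x, φ x • ∫ y, u y • k (y - x) := by
    intro j
    have hj : (0 : ℝ) < (j : ℝ) + 1 := by positivity
    rw [← hu.integral_smul_average hα k hφ.continuous hφc hj]
    simp_rw [hk _ hj]
  simp_rw [hconst] at h
  rw [tendsto_nhds_unique tendsto_const_nhds h]
  congr 1 with x
  simp only [Complex.real_smul, mul_comm]

variable [Nontrivial E]

theorem WeakHarmonic.exists_affine (h0 : 0 < α) (h2 : α < 2) (hu : WeakHarmonic α u) :
    (∃ (b : E) (c : ℝ), ∀ᵐ x, u x = inner ℝ b x + c) ∧
      (α ≤ 1 → ∃ c : ℝ, ∀ᵐ x, u x = c) := by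
  obtain ⟨k, hk1, hk⟩ := hu.exists_scale_invariant_kernel h0 h2
  have hae := hu.ae_eq_average h0.le hk1 hk
  constructor
  · obtain ⟨b, hb⟩ := exists_affine_of_second_difference
      -- The kernel is complex-valued; the real part suffices since the average equals the real `u`
      -- almost everywhere.
      (F := fun x => (∫ y, u y • k (y - x)).re)
      (Complex.continuous_re.comp (hu.continuous_integral_translate h0.le k))
      (fun x a b => by
        simpa using congrArg Complex.re (hu.second_difference_eq_zero h0 h2 hk x a b))
    refine ⟨b, (∫ y, u y • k (y - 0)).re, ?_⟩
    filter_upwards [hae] with x hx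
    rw [← hb x, ← hx, Complex.ofReal_re]
  · intro h1
    refine ⟨(∫ y, u y • k (y - 0)).re, ?_⟩
    filter_upwards [hae] with x hx
    have h := hu.first_difference_eq_zero h0 h1 hk 0 x
    rw [zero_add, ← hx, sub_eq_zero] at h
    rw [← h, Complex.ofReal_re]

end Identification

end FracLaplace

end

theorem theorem2 (n : ℕ) (α : ℝ) (hα0 : 0 < α) (hα2 : α < 2)
    (u : EuclideanSpace ℝ (Fin n) → ℝ) (hu : FracLaplace.IsAlphaHarmonic α u) :
    (∃ (b : EuclideanSpace ℝ (Fin n)) (c : ℝ),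
        ∀ᵐ x ∂(volume : Measure (EuclideanSpace ℝ (Fin n))), u x = inner ℝ b x + c) ∧
      (α ≤ 1 → ∃ c : ℝ,
        ∀ᵐ x ∂(volume : Measure (EuclideanSpace ℝ (Fin n))), u x = c) := by
  -- The analysis requires a nontrivial space; in dimension 0 every function is constant.
  rcases Nat.eq_zero_or_pos n with rfl | hn
  · have h : ∀ x, u x = u 0 := fun x => congrArg u (Subsingleton.elim x 0)
    exact ⟨⟨0, u 0, Eventually.of_forall fun x => by rw [inner_zero_left, zero_add, h x]⟩,
      fun _ => ⟨u 0, Eventually.of_forall h⟩⟩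
  · have : Nonempty (Fin n) := ⟨⟨0, hn⟩⟩
    exact (hu.weakHarmonic hn hα0 hα2).exists_affine hα0 hα2
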